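/- Conventions. $G$ is a finite abelian group with dual group $\widehat G$ of complex characters; $\mu$ is the uniform probability measure on $G$, and for non-empty $X\subseteq G$ put $\mu_X=\mu(X)^{-1}1_X$. For $f,g\colon G\to\mathbb C$ put $(f*g)(x)=\mathbb E_{y\in G}f(y)g(x-y)$, $(f\circ g)(x)=\mathbb E_{y\in G}f(y)\overline{g(y-x)}$ and $\langle f,g\rangle=\mathbb E_{x\in G}f(x)\overline{g(x)}$. Write $\mathcal L(x)=\log(2/x)$ for $x\in(0,1]$. For a non-empty $\Gamma\subseteq\widehat G$ and $\rho\ge 0$, the Bohr set of rank $d=|\Gamma|$ and width $\rho$ is $\mathrm{Bohr}(\Gamma;\rho)=\{x\in G:|\gamma(x)-1|\le\rho\text{ for all }\gamma\in\Gamma\}$, where $\Gamma$ and $\rho$ are regarded as part of the data; its $\delta$-dilate is $\mathrm{Bohr}(\Gamma;\rho)_\delta=\mathrm{Bohr}(\Gamma;\delta\rho)$. A Bohr set $B$ of rank $d$ is regular if $(1-100\delta d)|B|\le|B_{1-\delta}|\le|B_{1+\delta}|\le(1+100\delta d)|B|$ for all $\delta\in(0,1/(100d)]$. Theorem A.4.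 There are absolute constants $c,C,\kappa>0$ such that the following holds for every finite abelian group $G$. Let $B\subseteq G$ be non-empty and let $A_1,A_2\subseteq B$ be subsets of densities $\alpha_1=|A_1|/|B|>0$ and $\alpha_2=|A_2|/|B|>0$. Let $B^{(1)}$ and $B^{(2)}=\mathrm{Bohr}(\Gamma;\rho)$, where $\rho\in[0,2]$, be regular Bohr sets of rank $d$ in $G$ such that $B^{(2)}\subseteq B^{(1)}_{c/d}$. Let $A_1'\subseteq B^{(1)}$ and $A_2'\subseteq B^{(2)}$ be subsets of densities $\alpha_1'=|A_1'|/|B^{(1)}|>0$ and $\alpha_2'=|A_2'|/|B^{(2)}|>0$. Let $\varepsilon\in(0,1]$ and let $S\subseteq B^{(1)}-B^{(2)}$ be a set such that (i) $\langle\mu_{A_1'}\circ\mu_{A_2'},1_S\rangle\ge 1-\frac{\varepsilon}{16}$; (ii) $(\mu_{A_1}\circ\mu_{A_2})(x)\ge\bigl(1+\frac34\varepsilon\bigr)\mu(B)^{-1}$ for all $x\in S$. Then there exist a non-empty set $\Delta\subseteq\widehat G$, of size $d'=|\Delta|$, and a real number $\rho'$ such that \[d'\le C\varepsilon^{-2}\mathcal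 L\bigl(\varepsilon(\alpha_1\alpha_2)^{1/2}\bigr)^2\mathcal L(\alpha_1')\mathcal L(\alpha_2'),\qquad \rho'\ge\kappa\,\frac{\rho\,\varepsilon(\alpha_1\alpha_2)^{1/2}}{d^3d'},\] and $B'=\mathrm{Bohr}(\Gamma\cup\Delta;\rho')$ is a regular Bohr set with \[\lVert\mu_{A_1}*\mu_{B'}\rVert_\infty\ge\Bigl(1+\frac{\varepsilon}{2}\Bigr)\mu(B)^{-1}.\] -/

import Mathlib

open scoped BigOperators Pointwise ComplexConjugate

noncomputable section

namespace AlmostPeriodicity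

/-- `L(x) = log (2 / x)`, used for `x ∈ (0, 1]`. -/
def logFactor (x : ℝ) : ℝ := Real.log (2 / x)

/-- The density of `A` in `B`, used for `A ⊆ B` with `B` non-empty. -/
def relDensity {G : Type*} (A B : Finset G) : ℝ := (A.card : ℝ) / (B.card : ℝ)

section Functions

variable {G : Type*} [Fintype G]

/-- The uniform probability measure `μ(S)` of a subset `S` of a finite set `G`. -/
def unifMeasure (S : Finset G) : ℝ := (S.card : ℝ) / (Fintype.card G : ℝ)

/-- The indicator function `1_S`. -/
def ind (S : Finset G) : G → ℝ := Set.indicator (S : Set G) 1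

/-- The normalised indicator function `μ_S = μ(S)⁻¹ 1_S` of a non-empty set `S`. -/
def normInd (S : Finset G) : G → ℝ := fun x => (unifMeasure S)⁻¹ * ind S x

variable {𝕜 : Type*} [RCLike 𝕜]

/-- The inner product `⟨f, g⟩ = 𝔼 x, f x * conj (g x)` with respect to the uniform probability
measure on `G`. -/
def innerProd (f g : G → 𝕜) : 𝕜 := 𝔼 x : G, f x * conj (g x)

variable [AddCommGroup G]

/-- The convolution `(f * g) x = 𝔼 y, f y * g (x - y)`. -/
def conv (f g : G → 𝕜) : G → 𝕜 := fun x => 𝔼 y : G, f y * g (x - y)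

/-- The difference convolution `(f ∘ g) x = 𝔼 y, f y * conj (g (y - x))`. -/
def diffConv (f g : G → 𝕜) : G → 𝕜 := fun x => 𝔼 y : G, f y * conj (g (y - x))

end Functions

section BohrSets

variable {G : Type*} [AddCommGroup G] [Fintype G]

open Classical in
/-- The Bohr set `Bohr(Γ; ρ)` of a finite abelian group `G`, as a subset of `G`. The frequency set
`Γ` is a (non-empty) set of characters of `G`, its cardinality is the rank of the Bohr set, and
`ρ ≥ 0` is the width. The `δ`-dilate of `Bohr(Γ; ρ)` is `Bohr(Γ; δ * ρ)`. -/
def bohr (Γ : Finset (AddChar G ℂ)) (ρ : ℝ) : Finset G :=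
  {x : G | ∀ γ ∈ Γ, ‖γ x - 1‖ ≤ ρ}

/-- Regularity of the Bohr set with frequency set `Γ` and width `ρ`, with `d = |Γ|` its rank:
`(1 - 100 δ d) |B| ≤ |B_{1 - δ}| ≤ |B_{1 + δ}| ≤ (1 + 100 δ d) |B|` for `0 < δ ≤ 1 / (100 d)`. -/
def IsRegularBohr (Γ : Finset (AddChar G ℂ)) (ρ : ℝ) : Prop :=
  ∀ δ : ℝ, 0 < δ → δ ≤ 1 / (100 * (Γ.card : ℝ)) →
    (1 - 100 * δ * (Γ.card : ℝ)) * ((bohr Γ ρ).card : ℝ) ≤ ((bohr Γ ((1 - δ) * ρ)).card : ℝ) ∧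
    ((bohr Γ ((1 - δ) * ρ)).card : ℝ) ≤ ((bohr Γ ((1 + δ) * ρ)).card : ℝ) ∧
    ((bohr Γ ((1 + δ) * ρ)).card : ℝ) ≤ (1 + 100 * δ * (Γ.card : ℝ)) * ((bohr Γ ρ).card : ℝ)

end BohrSets

end AlmostPeriodicity

end

open AlmostPeriodicity

noncomputable section

namespace AlmostPeriodicity

/-! ### Disjoint intervals and monotone functions -/

/-! Write `W = μ_{A₁} ∘ μ_{A₂}`, `τ = (1 + 3ε/4) μ(B)⁻¹` and `σ = ε √(α₁α₂)`. The plan is to smooth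
`W` until it is nearly constant on translates of a Bohr set `B'`, while keeping an average of it
large. Averages of `W` over translates of `B'` are averages of values of `μ_{A₁} * μ_{B'}`, so the
sup norm must then be large.

Almost periods. Random sampling from `A₂'` (Croot–Sisask, `exists_almost_periods`) yields a dense
subset `X` of a Bohr set such that shifting by a difference of two elements of `X` changes `1_S`,
averaged over `A₂'`, by little in `L¹` on every set of size `|A₁'|`. Averaging `k` times over `X -
X` therefore costs at most `ε/16` of the mass that `μ_{A₁'} ∘ μ_{A₂'}` gives to `S`. Since `W ≥ τ
1_S`, the smoothed `W` has mean at least `τ (1 - ε/8)` against `μ_{A₁'} ∘ μ_{A₂'}`.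

Fourier side. Each averaging step multiplies the coefficient of `W` at `γ` by the squared modulus of
the mean of `γ` over `X`, so after `k ≈ log(1/σ)` steps only the characters with mean at least `1/2`
matter. Chang's lemma relative to a Bohr set (`local_chang`, by way of Rudin's inequality) controls
all of these by about `log(1/density of X)` characters, which supply `Δ`
(`exists_bohr_annihilating`). By Parseval and Cauchy–Schwarz the coefficients of `W` have absolute
sum at most `(α₁α₂)^(-1/2) μ(B)⁻¹`, so accuracy `σ/32` costs only `(ε/32) μ(B)⁻¹`.
`abs_shiftAvg_sub_le` and `le_norm_conv_of_almost_periods` put the two halves together. -/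

lemma sum_growth_le {ι : Type*} {f : ℝ → ℝ} (hf : Monotone f) (A : ℝ) (c s : ι → ℝ)
    (hs : ∀ i, 0 < s i) (F : Finset ι)
    (hF : (F : Set ι).PairwiseDisjoint fun i => Metric.closedBall (c i) (s i)) :
    ∀ B, A ≤ B → (∀ i ∈ F, A ≤ c i - s i ∧ c i + s i ≤ B) →
      ∑ i ∈ F, (f (c i + s i) - f (c i - s i)) ≤ f B - f A := by
  classical
  -- The interval with the largest left endpoint is removed. By disjointness the others end before
  -- it starts, so the induction hypothesis applies with that endpoint in place of `B`.
  induction F using Finset.induction_on_max_value (fun i => c i - s i) with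
  | empty => intro B hAB _; simpa using hf hAB
  | insert i F hi hmax ih =>
    intro B hAB hB
    rw [Finset.sum_insert hi]
    have hi' := hB i (Finset.mem_insert_self _ _)
    have hsub : ((F : Finset ι) : Set ι) ⊆ ((insert i F : Finset ι) : Set ι) := by
      intro x hx; simp at hx ⊢; exact Or.inr hx
    have h1 := ih (hF.subset hsub) (c i - s i) hi'.1 (fun j hj => by
      refine ⟨(hB j (Finset.mem_insert_of_mem hj)).1, ?_⟩
      by_contra! hlt
      have hne : i ≠ j := fun h => hi (h ▸ hj)
      have hd := hF (Finset.mem_coe.2 (Finset.mem_insert_self i F))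
        (Finset.mem_coe.2 (Finset.mem_insert_of_mem hj)) hne
      simp only [Function.onFun, Real.closedBall_eq_Icc] at hd
      exact Set.disjoint_left.1 hd (show c i - s i ∈ _ from ⟨le_rfl, by linarith [hs i]⟩)
        ⟨hmax j hj, hlt.le⟩)
    have h2 := hf hi'.2
    linarith

/-- If every point of `[a, b]` lies in a ball on which the monotone function `f` grows at rate at
least `K`, then `f` grows at least by `K * (b - a) / 4`. -/
lemma mul_length_le_of_growth {f : ℝ → ℝ} (hf : Monotone f) {A B a b K : ℝ} (hAB : A ≤ B)
    (hK : 0 < K)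
    (h : ∀ r ∈ Set.Icc a b, ∃ c s, 0 < s ∧ r ∈ Metric.closedBall c s ∧ A ≤ c - s ∧ c + s ≤ B ∧
      K * (2 * s) ≤ f (c + s) - f (c - s)) :
    K * (b - a) ≤ 4 * (f B - f A) := by
  have h' : ∀ r : Set.Icc a b, ∃ c s, 0 < s ∧ (r : ℝ) ∈ Metric.closedBall c s ∧ A ≤ c - s ∧
      c + s ≤ B ∧ K * (2 * s) ≤ f (c + s) - f (c - s) := fun r => h r r.2
  choose c s hs hr hA hB hK' using h'
  -- Vitali covering: the enlarged balls of a disjoint subfamily cover `[a, b]`. The enlargement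
  -- factor 4 is the factor lost in the conclusion.
  obtain ⟨u, -, hdisj, hcov⟩ := Vitali.exists_disjoint_subfamily_covering_enlargement_closedBall
    (Set.univ : Set (Set.Icc a b)) c s (B - A)
    (fun r _ => by linarith [hA r, hB r, hs r]) 4 (by norm_num)
  have hcount : u.Countable := hdisj.countable_of_nonempty_interior fun i _ => by
    rw [Real.closedBall_eq_Icc, interior_Icc]
    exact ⟨c i, by linarith [hs i], by linarith [hs i]⟩
  have hfin : ∀ F : Finset u, ∑ i ∈ F, ENNReal.ofReal (2 * (4 * s i)) ≤
      ENNReal.ofReal (4 / K * (f B - f A)) := by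
    intro F
    rw [← ENNReal.ofReal_sum_of_nonneg (fun i _ => by linarith [hs i])]
    apply ENNReal.ofReal_le_ofReal
    have h1 := sum_growth_le hf A (fun i : u => c i) (fun i : u => s i) (fun i => hs i) F
      (fun i _ j _ hij => hdisj i.2 j.2 (fun h => hij (Subtype.ext h))) B hAB
      (fun i _ => ⟨hA i, hB i⟩)
    have h2 : ∑ i ∈ F, K * (2 * s (i : Set.Icc a b)) ≤ f B - f A :=
      (Finset.sum_le_sum fun (i : u) _ => hK' i).trans h1
    rw [← Finset.mul_sum] at h2
    have h3 : ∑ i ∈ F, 2 * (4 * s (i : Set.Icc a b)) = 4 * ∑ i ∈ F, 2 * s (i : Set.Icc a b) := by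
      rw [Finset.mul_sum]; exact Finset.sum_congr rfl fun i _ => by ring
    rw [h3, div_mul_eq_mul_div, le_div_iff₀ hK]
    nlinarith
  have hvol : MeasureTheory.volume (Set.Icc a b) ≤ ENNReal.ofReal (4 / K * (f B - f A)) := by
    have : Set.Icc a b ⊆ ⋃ i ∈ u, Metric.closedBall (c i) (4 * s i) := by
      intro r hrab
      obtain ⟨j, hj, hsub⟩ := hcov ⟨r, hrab⟩ (Set.mem_univ _)
      exact Set.mem_biUnion hj (hsub (hr ⟨r, hrab⟩))
    refine (MeasureTheory.measure_mono this).trans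
      ((MeasureTheory.measure_biUnion_le _ hcount _).trans ?_)
    simp only [Real.volume_closedBall]
    rw [ENNReal.tsum_eq_iSup_sum]
    exact iSup_le hfin
  rw [Real.volume_Icc] at hvol
  have h0 : 0 ≤ 4 / K * (f B - f A) := mul_nonneg (by positivity) (sub_nonneg.2 (hf hAB))
  have := (ENNReal.ofReal_le_ofReal_iff h0).1 hvol
  rw [div_mul_eq_mul_div, le_div_iff₀ hK] at this
  linarith

/-! ### Bohr sets -/

section Bohr

variable {G : Type*} [AddCommGroup G] [Fintype G]

lemma mem_bohr {Γ : Finset (AddChar G ℂ)} {ρ : ℝ} {x : G} :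
    x ∈ bohr Γ ρ ↔ ∀ γ ∈ Γ, ‖γ x - 1‖ ≤ ρ := by
  simp [bohr]

lemma zero_mem_bohr {Γ : Finset (AddChar G ℂ)} {ρ : ℝ} (hρ : 0 ≤ ρ) : (0 : G) ∈ bohr Γ ρ := by
  simp [mem_bohr, hρ]

lemma bohr_nonempty {Γ : Finset (AddChar G ℂ)} {ρ : ℝ} (hρ : 0 ≤ ρ) : (bohr Γ ρ).Nonempty :=
  ⟨0, zero_mem_bohr hρ⟩

lemma bohr_mono (Γ : Finset (AddChar G ℂ)) {ρ ρ' : ℝ} (h : ρ ≤ ρ') : bohr Γ ρ ⊆ bohr Γ ρ' :=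
  fun _ hx => mem_bohr.2 fun γ hγ => (mem_bohr.1 hx γ hγ).trans h

lemma bohr_anti {Γ Γ' : Finset (AddChar G ℂ)} (h : Γ ⊆ Γ') (ρ : ℝ) : bohr Γ' ρ ⊆ bohr Γ ρ :=
  fun _ hx => mem_bohr.2 fun γ hγ => mem_bohr.1 hx γ (h hγ)

lemma norm_apply_sub (γ : AddChar G ℂ) (x y : G) : ‖γ (x - y) - 1‖ = ‖γ x - γ y‖ := by
  have h : γ (x - y) - 1 = (γ x - γ y) / γ y := by
    rw [AddChar.map_sub_eq_div]
    have : γ y ≠ 0 := (AddChar.val_isUnit γ y).ne_zero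
    field_simp
  rw [h, norm_div, AddChar.norm_apply, div_one]

lemma norm_apply_neg_sub_one (γ : AddChar G ℂ) (x : G) : ‖γ (-x) - 1‖ = ‖γ x - 1‖ := by
  have := norm_apply_sub γ 0 x
  rw [zero_sub, AddChar.map_zero_eq_one] at this
  rw [this, norm_sub_rev]

lemma neg_mem_bohr {Γ : Finset (AddChar G ℂ)} {ρ : ℝ} {x : G} (hx : x ∈ bohr Γ ρ) :
    -x ∈ bohr Γ ρ :=
  mem_bohr.2 fun γ hγ => by rw [norm_apply_neg_sub_one]; exact mem_bohr.1 hx γ hγ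

lemma norm_apply_add_sub_one_le (γ : AddChar G ℂ) (x y : G) :
    ‖γ (x + y) - 1‖ ≤ ‖γ x - 1‖ + ‖γ y - 1‖ := by
  have h : γ (x + y) - 1 = γ y * (γ x - 1) + (γ y - 1) := by rw [AddChar.map_add_eq_mul]; ring
  rw [h]
  refine (norm_add_le _ _).trans ?_
  rw [norm_mul, AddChar.norm_apply, one_mul]

lemma add_mem_bohr {Γ : Finset (AddChar G ℂ)} {ρ ρ' : ℝ} {x y : G} (hx : x ∈ bohr Γ ρ)
    (hy : y ∈ bohr Γ ρ') : x + y ∈ bohr Γ (ρ + ρ') :=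
  mem_bohr.2 fun γ hγ => (norm_apply_add_sub_one_le γ x y).trans
    (add_le_add (mem_bohr.1 hx γ hγ) (mem_bohr.1 hy γ hγ))

lemma sub_mem_bohr {Γ : Finset (AddChar G ℂ)} {ρ ρ' : ℝ} {x y : G} (hx : x ∈ bohr Γ ρ)
    (hy : y ∈ bohr Γ ρ') : x - y ∈ bohr Γ (ρ + ρ') := by
  rw [sub_eq_add_neg]; exact add_mem_bohr hx (neg_mem_bohr hy)

/-- Two points in the same square cell of side `ρ/6` are at distance at most `√2 ρ/6 < ρ/4`. -/
lemma norm_sub_le_of_floor_eq {z w : ℂ} {ρ : ℝ} (hρ : 0 < ρ)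
    (hre : ⌊6 * (z.re - 1) / ρ⌋ = ⌊6 * (w.re - 1) / ρ⌋)
    (him : ⌊6 * z.im / ρ⌋ = ⌊6 * w.im / ρ⌋) : ‖z - w‖ ≤ ρ / 4 := by
  have h1 := Int.abs_sub_lt_one_of_floor_eq_floor hre
  have h2 := Int.abs_sub_lt_one_of_floor_eq_floor him
  rw [← sub_div, abs_div, abs_of_pos hρ, div_lt_one hρ] at h1 h2
  have h3 : |6 * (z - w).re| < ρ := by
    rwa [Complex.sub_re, show 6 * (z.re - w.re) = 6 * (z.re - 1) - 6 * (w.re - 1) by ring]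
  have h4 : |6 * (z - w).im| < ρ := by
    rwa [Complex.sub_im, mul_sub]
  have h5 := sq_lt_sq' (abs_lt.1 h3).1 (abs_lt.1 h3).2
  have h6 := sq_lt_sq' (abs_lt.1 h4).1 (abs_lt.1 h4).2
  have h7 : ‖z - w‖ ^ 2 ≤ (ρ / 4) ^ 2 := by
    rw [← Complex.normSq_eq_norm_sq, Complex.normSq_apply]
    nlinarith
  exact le_of_sq_le_sq h7 (by positivity)

lemma floor_mem_Icc {y ρ : ℝ} (hρ : 0 < ρ) (hy : |y| ≤ ρ) :
    ⌊6 * y / ρ⌋ ∈ Finset.Icc (-6 : ℤ) 6 := by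
  have h := abs_le.1 hy
  rw [Finset.mem_Icc]
  constructor
  · rw [Int.le_floor, le_div_iff₀ hρ]; push_cast; linarith
  · have h1 : 6 * y / ρ ≤ 6 := by rw [div_le_iff₀ hρ]; linarith
    have h2 : ((⌊6 * y / ρ⌋ : ℤ) : ℝ) ≤ ((6 : ℤ) : ℝ) := (Int.floor_le _).trans (by simpa using h1)
    exact_mod_cast h2

/-- Pigeonhole: the values of each character on the Bohr set fall into `13² = 169` square cells, and
subtracting a fixed element maps the points sharing all cells injectively into the Bohr set of width
`ρ/4`. -/
lemma card_bohr_le (Γ : Finset (AddChar G ℂ)) {ρ : ℝ} (hρ : 0 < ρ) :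
    (bohr Γ ρ).card ≤ (bohr Γ (ρ / 4)).card * 169 ^ Γ.card := by
  classical
  let cell : G → Γ → ℤ × ℤ := fun x γ =>
    (⌊6 * ((γ.1 x).re - 1) / ρ⌋, ⌊6 * (γ.1 x).im / ρ⌋)
  let box : Finset (Γ → ℤ × ℤ) :=
    Fintype.piFinset fun _ => Finset.Icc (-6 : ℤ) 6 ×ˢ Finset.Icc (-6 : ℤ) 6
  have hbox : box.card = 169 ^ Γ.card := by
    simp [box]
  rw [← hbox]
  refine Finset.card_le_mul_card_image_of_maps_to (f := cell) (t := box) ?_ _ ?_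
  · intro x hx
    refine Fintype.mem_piFinset.2 fun γ => ?_
    have h := mem_bohr.1 hx γ.1 γ.2
    refine Finset.mem_product.2 ⟨floor_mem_Icc hρ ?_, floor_mem_Icc hρ ?_⟩
    · refine le_trans ?_ h
      simpa using Complex.abs_re_le_norm (γ.1 x - 1)
    · refine le_trans ?_ h
      simpa using Complex.abs_im_le_norm (γ.1 x - 1)
  · intro b _
    rcases Finset.eq_empty_or_nonempty {a ∈ bohr Γ ρ | cell a = b} with h | ⟨a₀, ha₀⟩
    · rw [h]; simp
    · refine Finset.card_le_card_of_injOn (fun a => a - a₀) ?_ ?_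
      · intro a ha
        rw [Finset.mem_coe, Finset.mem_filter] at ha
        rw [Finset.mem_filter] at ha₀
        refine Finset.mem_coe.2 (mem_bohr.2 fun γ hγ => ?_)
        have hab := congrFun (ha.2.trans ha₀.2.symm) ⟨γ, hγ⟩
        rw [norm_apply_sub]
        exact norm_sub_le_of_floor_eq hρ (congrArg Prod.fst hab) (congrArg Prod.snd hab)
      · intro a _ a' _ h
        simpa using h

lemma bohr_card_pos (Γ : Finset (AddChar G ℂ)) {ρ : ℝ} (hρ : 0 ≤ ρ) :
    (0 : ℝ) < (bohr Γ ρ).card := by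
  exact_mod_cast (bohr_nonempty hρ).card_pos

lemma monotone_log_card_bohr (Γ : Finset (AddChar G ℂ)) :
    Monotone fun r => Real.log ((bohr Γ r).card : ℝ) := by
  intro r r' h
  rcases Nat.eq_zero_or_pos (bohr Γ r).card with h0 | h0
  · simp only [h0, Nat.cast_zero, Real.log_zero]
    exact Real.log_natCast_nonneg _
  · exact Real.log_le_log (by exact_mod_cast h0)
      (by exact_mod_cast Finset.card_le_card (bohr_mono Γ h))

lemma isRegularBohr_zero (Γ : Finset (AddChar G ℂ)) : IsRegularBohr Γ 0 := by
  intro δ hδ _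
  simp only [mul_zero, le_refl, true_and]
  have : 0 ≤ 100 * δ * (Γ.card : ℝ) * ((bohr Γ 0).card : ℝ) := by positivity
  constructor <;> linarith

/-- Every Bohr set has a regular dilate. -/
lemma exists_isRegularBohr {Γ : Finset (AddChar G ℂ)} (hΓ : Γ.Nonempty) {w : ℝ} (hw : 0 ≤ w) :
    ∃ ρ, w / 3 ≤ ρ ∧ ρ ≤ 2 * w / 3 ∧ IsRegularBohr Γ ρ := by
  rcases hw.eq_or_lt with rfl | hw
  · exact ⟨0, by norm_num, by norm_num, isRegularBohr_zero Γ⟩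
  by_contra! hcon
  set d : ℝ := (Γ.card : ℝ) with hd
  have hd1 : 1 ≤ d := by rw [hd]; exact_mod_cast hΓ.card_pos
  set f : ℝ → ℝ := fun r => Real.log ((bohr Γ r).card : ℝ) with hf
  -- If `r` is not regular, then on an interval of length `δr` with `r` as an endpoint, the
  -- logarithm of the size grows by at least `50δd`; as `r ≤ 2w/3`, this is a rate of at least
  -- `75d/w`. The total growth is then at least `25d/4`, whereas the covering bound `hcov` allows
  -- only `6d`.
  have key : 75 * d / w * (2 * w / 3 - w / 3) ≤ 4 * (f w - f (w / 4)) := by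
    refine mul_length_le_of_growth (monotone_log_card_bohr Γ) (by linarith) (by positivity) ?_
    rintro r ⟨hr1, hr2⟩
    have hnr := hcon r hr1 hr2
    have hr0 : 0 < r := by linarith
    unfold IsRegularBohr at hnr
    push Not at hnr
    obtain ⟨δ, hδ, hδ', hfail⟩ := hnr
    rw [← hd] at hδ' hfail
    have hx : 100 * δ * d ≤ 1 := by
      rw [le_div_iff₀ (by positivity)] at hδ'
      linarith
    have hδ1 : δ ≤ 1 / 100 := by nlinarith
    have hxpos : 0 < 100 * δ * d := by positivity
    have hrate : 75 * d / w * (δ * r) ≤ 100 * δ * d / 2 := by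
      rw [div_mul_eq_mul_div, div_le_iff₀ hw]
      have : 0 ≤ d * δ := by positivity
      nlinarith
    have hb0 := bohr_card_pos Γ hr0.le
    by_cases hlow : (1 - 100 * δ * d) * ((bohr Γ r).card : ℝ) ≤ (bohr Γ ((1 - δ) * r)).card
    · have hmid : ((bohr Γ ((1 - δ) * r)).card : ℝ) ≤ (bohr Γ ((1 + δ) * r)).card := by
        exact_mod_cast Finset.card_le_card (bohr_mono Γ (by nlinarith))
      have hup := hfail hlow hmid
      refine ⟨(1 + δ / 2) * r, δ * r / 2, by positivity, ?_, ?_, ?_, ?_⟩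
      · rw [Real.closedBall_eq_Icc]; constructor <;> nlinarith
      · linarith
      · nlinarith
      · have e1 : (1 + δ / 2) * r + δ * r / 2 = (1 + δ) * r := by ring
        have e2 : (1 + δ / 2) * r - δ * r / 2 = r := by ring
        have e3 : 2 * (δ * r / 2) = δ * r := by ring
        rw [e1, e2, e3]
        refine hrate.trans ?_
        have hl : Real.log ((1 + 100 * δ * d) * ((bohr Γ r).card : ℝ)) ≤
            Real.log ((bohr Γ ((1 + δ) * r)).card : ℝ) :=
          Real.log_le_log (by positivity) hup.le
        rw [Real.log_mul (by positivity) hb0.ne'] at hl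
        have h2 := Real.one_sub_inv_le_log_of_pos (show 0 < 1 + 100 * δ * d by positivity)
        have h3 : (1 + 100 * δ * d)⁻¹ ≤ 1 - 100 * δ * d / 2 := by
          rw [inv_le_iff_one_le_mul₀ (by positivity)]
          nlinarith
        linarith
    · push Not at hlow
      have hc0 := bohr_card_pos Γ (show 0 ≤ (1 - δ) * r by nlinarith)
      refine ⟨(1 - δ / 2) * r, δ * r / 2, by positivity, ?_, ?_, ?_, ?_⟩
      · rw [Real.closedBall_eq_Icc]; constructor <;> nlinarith
      · nlinarith
      · nlinarith
      · have e1 : (1 - δ / 2) * r + δ * r / 2 = r := by ring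
        have e2 : (1 - δ / 2) * r - δ * r / 2 = (1 - δ) * r := by ring
        have e3 : 2 * (δ * r / 2) = δ * r := by ring
        rw [e1, e2, e3]
        refine hrate.trans ?_
        have hpos : 0 < 1 - 100 * δ * d := by
          by_contra! hneg
          nlinarith
        have hl := Real.log_le_log hc0 hlow.le
        rw [Real.log_mul hpos.ne' hb0.ne'] at hl
        have h2 := Real.log_le_sub_one_of_pos hpos
        linarith
  have hcov : f w ≤ f (w / 4) + d * 6 := by
    have h1 : ((bohr Γ w).card : ℝ) ≤ (bohr Γ (w / 4)).card * 169 ^ Γ.card := by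
      exact_mod_cast card_bohr_le Γ hw
    have h2 := Real.log_le_log (bohr_card_pos Γ hw.le) h1
    rw [Real.log_mul (bohr_card_pos Γ (by positivity)).ne' (by positivity), Real.log_pow] at h2
    have h3 : Real.log 169 ≤ 6 := by
      rw [Real.log_le_iff_le_exp (by norm_num)]
      have he : Real.exp 6 = Real.exp 1 ^ 6 := by rw [← Real.exp_nat_mul]; norm_num
      rw [he]
      have := Real.exp_one_gt_d9
      calc (169 : ℝ) ≤ 2.7 ^ 6 := by norm_num
        _ ≤ Real.exp 1 ^ 6 := by gcongr; linarith
    simp only [hf]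
    have : (Γ.card : ℝ) * Real.log 169 ≤ d * 6 := by rw [hd]; gcongr
    linarith
  have e : 75 * d / w * (2 * w / 3 - w / 3) = 25 * d := by field_simp; ring
  rw [e] at key
  linarith

lemma IsRegularBohr.card_dilate_le {Γ : Finset (AddChar G ℂ)} {ρ : ℝ} (h : IsRegularBohr Γ ρ)
    (hΓ : Γ.Nonempty) :
    ((bohr Γ ((1 + 1 / (100 * (Γ.card : ℝ))) * ρ)).card : ℝ) ≤ 2 * (bohr Γ ρ).card := by
  have hd : (0 : ℝ) < Γ.card := by exact_mod_cast hΓ.card_pos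
  refine (h (1 / (100 * (Γ.card : ℝ))) (by positivity) le_rfl).2.2.trans (le_of_eq ?_)
  field_simp
  ring

/-- Summing a bounded function over a regular Bohr set is almost invariant under small
translations. -/
lemma IsRegularBohr.norm_sum_shift_sub_le {Γ : Finset (AddChar G ℂ)} {ρ δ : ℝ}
    (h : IsRegularBohr Γ ρ) (hδ : 0 < δ) (hδ' : δ ≤ 1 / (100 * (Γ.card : ℝ))) {t : G}
    (ht : t ∈ bohr Γ (δ * ρ)) {ψ : G → ℂ} (hψ : ∀ x, ‖ψ x‖ ≤ 1) :
    ‖∑ x ∈ bohr Γ ρ, ψ (x + t) - ∑ x ∈ bohr Γ ρ, ψ x‖ ≤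
      200 * δ * Γ.card * (bohr Γ ρ).card := by
  classical
  set T := bohr Γ ρ
  set I := bohr Γ ((1 - δ) * ρ)
  have himg : ∑ x ∈ T, ψ (x + t) = ∑ x ∈ T.image (· + t), ψ x := by
    rw [Finset.sum_image fun x _ y _ hxy => by simpa using hxy]
  have hcardimg : (T.image (· + t)).card = T.card :=
    Finset.card_image_of_injective _ (add_left_injective t)
  -- Both `T` and its translate `T + t` contain the shrunken Bohr set `I`, and by regularity each
  -- exceeds it by few points.
  have hdiff : ∀ U : Finset G, I ⊆ U → U.card = T.card →
      ‖∑ x ∈ U, ψ x - ∑ x ∈ I, ψ x‖ ≤ 100 * δ * Γ.card * T.card := by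
    intro U hIU hU
    rw [← Finset.sum_sdiff hIU, add_sub_cancel_right]
    refine (norm_sum_le_of_le _ fun x _ => hψ x).trans ?_
    rw [Finset.sum_const, nsmul_eq_mul, mul_one, Finset.cast_card_sdiff hIU, hU]
    have := (h δ hδ hδ').1
    change (1 - 100 * δ * (Γ.card : ℝ)) * (T.card : ℝ) ≤ (I.card : ℝ) at this
    linarith
  by_cases hρ : 0 ≤ ρ
  · have h1 := hdiff (T.image (· + t)) (fun x hx => by
      refine Finset.mem_image.2 ⟨x - t, ?_, by simp⟩
      exact bohr_mono Γ (by linarith) (sub_mem_bohr hx ht)) hcardimg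
    have h2 := hdiff T (bohr_mono Γ (by nlinarith)) rfl
    rw [himg]
    calc _ = ‖(∑ x ∈ T.image (· + t), ψ x - ∑ x ∈ I, ψ x) -
          (∑ x ∈ T, ψ x - ∑ x ∈ I, ψ x)‖ := by congr 1; ring
      _ ≤ _ := norm_sub_le _ _
      _ ≤ 100 * δ * Γ.card * T.card + 100 * δ * Γ.card * T.card := add_le_add h1 h2
      _ = _ := by ring
  -- With negative width, `t` can lie in the dilate only if there are no frequencies; then `T` is
  -- the whole group and the two sums agree.
  · have hΓ0 : Γ = ∅ := by
      by_contra hne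
      obtain ⟨γ, hγ⟩ := Finset.nonempty_iff_ne_empty.2 hne
      have := (norm_nonneg _).trans (mem_bohr.1 ht γ hγ)
      nlinarith
    have hT : T = Finset.univ := by
      ext x; simp [T, mem_bohr, hΓ0]
    rw [hT, Fintype.sum_equiv (Equiv.addRight t) (fun x => ψ (x + t)) ψ fun x => rfl]
    simp [hΓ0]

/-- If `x ≠ 0` then `∑ γ x` over all characters vanishes, so `|γ x - 1|` has mean at least 1. -/
lemma bohr_univ_eq_singleton {r : ℝ} (hr : 0 ≤ r) (hr' : r < 1) :
    bohr (Finset.univ : Finset (AddChar G ℂ)) r = {0} := by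
  refine Finset.eq_singleton_iff_unique_mem.2 ⟨zero_mem_bohr hr, fun x hx => ?_⟩
  by_contra hx0
  have h0 := AddChar.sum_apply_eq_zero_iff_ne_zero.2 hx0
  have hcard : (0 : ℝ) < Fintype.card (AddChar G ℂ) := by exact_mod_cast Fintype.card_pos
  have h1 : ‖∑ γ : AddChar G ℂ, (γ x - 1)‖ ≤ Fintype.card (AddChar G ℂ) * r := by
    refine (norm_sum_le_of_le _ fun γ hγ => mem_bohr.1 hx γ hγ).trans ?_
    simp
  rw [Finset.sum_sub_distrib, h0] at h1
  simp only [Finset.sum_const, Finset.card_univ, nsmul_eq_mul, mul_one, zero_sub, norm_neg,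
    Complex.norm_natCast] at h1
  nlinarith

end Bohr

/-! ### Averages of shifts -/

section ShiftAvg

variable {G : Type*} [AddCommGroup G] {ι κ : Type*}

/-- The average of the shifts of `f` by `φ i`, for `i ∈ D`. -/
def shiftAvg {E : Type*} [AddCommMonoid E] [Module ℚ≥0 E] (D : Finset ι) (φ : ι → G)
    (f : G → E) : G → E := fun x => 𝔼 i ∈ D, f (x + φ i)

lemma shiftAvg_comm {E : Type*} [AddCommMonoid E] [Module ℚ≥0 E] (D : Finset ι) (φ : ι → G)
    (D' : Finset κ) (φ' : κ → G) (f : G → E) :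
    shiftAvg D φ (shiftAvg D' φ' f) = shiftAvg D' φ' (shiftAvg D φ f) := by
  funext x
  simp only [shiftAvg]
  rw [Finset.expect_comm]
  simp only [add_right_comm]

lemma shiftAvg_iterate_comm {E : Type*} [AddCommMonoid E] [Module ℚ≥0 E] (D : Finset ι)
    (φ : ι → G) (D' : Finset κ) (φ' : κ → G) (k : ℕ) (f : G → E) :
    (shiftAvg D φ)^[k] (shiftAvg D' φ' f) = shiftAvg D' φ' ((shiftAvg D φ)^[k] f) :=
  (Function.Commute.iterate_left (shiftAvg_comm D φ D' φ') k).eq f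

lemma shiftAvg_mono (D : Finset ι) (φ : ι → G) {f g : G → ℝ} (h : ∀ x, f x ≤ g x) (x : G) :
    shiftAvg D φ f x ≤ shiftAvg D φ g x :=
  Finset.expect_le_expect fun _ _ => h _

lemma shiftAvg_iterate_mono (D : Finset ι) (φ : ι → G) (k : ℕ) :
    ∀ {f g : G → ℝ}, (∀ x, f x ≤ g x) →
      ∀ x, (shiftAvg D φ)^[k] f x ≤ (shiftAvg D φ)^[k] g x := by
  induction k with
  | zero => intro f g h x; exact h x
  | succ k ih => intro f g h x; exact ih (shiftAvg_mono D φ h) x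

lemma shiftAvg_iterate_const_mul (D : Finset ι) (φ : ι → G) (a : ℝ) (k : ℕ) :
    ∀ f : G → ℝ, (shiftAvg D φ)^[k] (fun x => a * f x) =
      fun x => a * (shiftAvg D φ)^[k] f x := by
  induction k with
  | zero => intro f; rfl
  | succ k ih =>
    intro f
    rw [Function.iterate_succ_apply, Function.iterate_succ_apply, ← ih]
    congr 1
    funext x
    simp only [shiftAvg, Finset.mul_expect]

lemma shiftAvg_ofReal (D : Finset ι) (φ : ι → G) (f : G → ℝ) :
    shiftAvg D φ (fun x => (f x : ℂ)) = fun x => ((shiftAvg D φ f x : ℝ) : ℂ) := by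
  funext x
  simp only [shiftAvg, Finset.expect_eq_sum_div_card]
  push_cast
  rfl

lemma shiftAvg_iterate_ofReal (D : Finset ι) (φ : ι → G) (k : ℕ) :
    ∀ f : G → ℝ, (shiftAvg D φ)^[k] (fun x => (f x : ℂ)) =
      fun x => (((shiftAvg D φ)^[k] f x : ℝ) : ℂ) := by
  induction k with
  | zero => intro f; rfl
  | succ k ih =>
    intro f
    rw [Function.iterate_succ_apply, shiftAvg_ofReal, ih]
    rfl

/-- Characters are eigenfunctions of averaging over shifts, with eigenvalue the mean of the
character over the shifts. -/
lemma shiftAvg_sum_char {Λ : Type*} (s : Finset Λ) (D : Finset ι) (φ : ι → G) (c : Λ → ℂ)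
    (γ : Λ → AddChar G ℂ) :
    shiftAvg D φ (fun x => ∑ l ∈ s, c l * γ l x) =
      fun x => ∑ l ∈ s, c l * (𝔼 i ∈ D, γ l (φ i)) * γ l x := by
  funext x
  simp only [shiftAvg]
  rw [Finset.expect_sum_comm]
  refine Finset.sum_congr rfl fun l _ => ?_
  rw [Finset.mul_expect, Finset.expect_mul]
  refine Finset.expect_congr rfl fun i _ => ?_
  rw [AddChar.map_add_eq_mul]
  ring

lemma shiftAvg_iterate_sum_char {Λ : Type*} (s : Finset Λ) (D : Finset ι) (φ : ι → G)
    (γ : Λ → AddChar G ℂ) (k : ℕ) : ∀ c : Λ → ℂ,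
    (shiftAvg D φ)^[k] (fun x => ∑ l ∈ s, c l * γ l x) =
      fun x => ∑ l ∈ s, c l * (𝔼 i ∈ D, γ l (φ i)) ^ k * γ l x := by
  induction k with
  | zero => intro c; simp
  | succ k ih =>
    intro c
    rw [Function.iterate_succ_apply, shiftAvg_sum_char, ih]
    funext x
    refine Finset.sum_congr rfl fun l _ => ?_
    ring

/-- If one averaging step changes `g` by at most `η` on average over every translate of `A`, then
`k` steps change it by at most `k * η`. -/
lemma expect_abs_shiftAvg_iterate_sub_le {D : Finset ι} (hD : D.Nonempty) (φ : ι → G)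
    (A : Finset G) {g : G → ℝ} {η : ℝ}
    (h : ∀ i ∈ D, ∀ u, 𝔼 x ∈ A, |g (x + u + φ i) - g (x + u)| ≤ η) (k : ℕ) (u : G) :
    𝔼 x ∈ A, |(shiftAvg D φ)^[k] g (x + u) - g (x + u)| ≤ k * η := by
  induction k generalizing u with
  | zero => simp
  | succ k ih =>
    rw [Function.iterate_succ_apply']
    set f := (shiftAvg D φ)^[k] g with hf
    have h1 : ∀ x, |shiftAvg D φ f (x + u) - g (x + u)| ≤
        𝔼 i ∈ D, (|f (x + (u + φ i)) - g (x + (u + φ i))| + |g (x + u + φ i) - g (x + u)|) := by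
      intro x
      have e : shiftAvg D φ f (x + u) - g (x + u) =
          𝔼 i ∈ D, (f (x + u + φ i) - g (x + u)) := by
        rw [Finset.expect_sub_distrib, Finset.expect_const hD, shiftAvg]
      rw [e]
      refine (Finset.abs_expect_le _ _).trans (Finset.expect_le_expect fun i _ => ?_)
      rw [← add_assoc]
      exact abs_sub_le _ _ _
    refine (Finset.expect_le_expect fun x _ => h1 x).trans ?_
    rw [Finset.expect_comm]
    refine Finset.expect_le hD fun i hi => ?_
    rw [Finset.expect_add_distrib]
    have := ih (u + φ i)
    have h2 := h i hi u
    push_cast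
    linarith

end ShiftAvg

/-! ### Indicator functions -/

section Indicator

lemma ind_apply {G : Type*} [DecidableEq G] (A : Finset G) (x : G) : ind A x = if x ∈ A then 1 else 0 := by
  simp [ind, Set.indicator_apply]

lemma ind_nonneg {G : Type*} (A : Finset G) (x : G) : 0 ≤ ind A x := by
  classical
  rw [ind_apply]; split_ifs <;> norm_num

lemma ind_le_one {G : Type*} (A : Finset G) (x : G) : ind A x ≤ 1 := by
  classical
  rw [ind_apply]; split_ifs <;> norm_num

variable {G : Type*} [Fintype G] [Nonempty G]

lemma unifMeasure_pos {A : Finset G} (hA : A.Nonempty) : 0 < unifMeasure A := by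
  have := hA.card_pos
  have : 0 < Fintype.card G := Fintype.card_pos
  unfold unifMeasure
  positivity

lemma normInd_nonneg (A : Finset G) (x : G) : 0 ≤ normInd A x :=
  mul_nonneg (inv_nonneg.2 (by unfold unifMeasure; positivity)) (ind_nonneg A x)

/-- Integrating against `μ_A` is averaging over `A`. -/
lemma expect_normInd_mul (A : Finset G) (f : G → ℝ) :
    𝔼 x, normInd A x * f x = 𝔼 x ∈ A, f x := by
  classical
  have hG : (Fintype.card G : ℝ) ≠ 0 := by exact_mod_cast Fintype.card_ne_zero
  rw [Fintype.expect_eq_sum_div_card, Finset.expect_eq_sum_div_card]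
  simp only [normInd, ind_apply, unifMeasure, mul_ite, mul_one, mul_zero, ite_mul, zero_mul]
  rw [Finset.sum_ite_mem, Finset.univ_inter, ← Finset.mul_sum]
  rw [inv_div]
  field_simp

lemma expect_norm_normInd_sq {A : Finset G} (hA : A.Nonempty) :
    𝔼 x, ‖(normInd A x : ℂ)‖ ^ 2 = (unifMeasure A)⁻¹ := by
  classical
  have h : ∀ x, ‖(normInd A x : ℂ)‖ ^ 2 = normInd A x * normInd A x := by
    intro x; rw [Complex.norm_real, Real.norm_eq_abs, sq_abs, sq]
  simp only [h]
  rw [expect_normInd_mul, Finset.expect_congr rfl (g := fun _ => (unifMeasure A)⁻¹),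
    Finset.expect_const hA]
  intro x hx
  simp [normInd, ind_apply, hx]

end Indicator

/-! ### Fourier coefficients -/

section Fourier

variable {G : Type*} [AddCommGroup G] [Fintype G]

/-- The Fourier coefficient of `f` at `γ`. -/
def dft (f : G → ℂ) (γ : AddChar G ℂ) : ℂ := 𝔼 x, f x * conj (γ x)

/-- Fourier inversion for difference convolutions. -/
lemma diffConv_eq_sum_dft (f g : G → ℂ) (y : G) :
    diffConv f g y = ∑ γ : AddChar G ℂ, dft f γ * conj (dft g γ) * γ y := by
  classical
  have h : ∀ γ : AddChar G ℂ, dft f γ * conj (dft g γ) * γ y =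
      𝔼 u, 𝔼 v, f u * conj (g v) * γ (v - (u - y)) := by
    intro γ
    have hc : conj (dft g γ) = 𝔼 v, conj (g v) * γ v := by
      rw [dft, Fintype.expect_eq_sum_div_card, Fintype.expect_eq_sum_div_card]
      simp
    rw [hc, dft, Finset.expect_mul_expect, Finset.expect_mul]
    refine Finset.expect_congr rfl fun u _ => ?_
    rw [Finset.expect_mul]
    refine Finset.expect_congr rfl fun v _ => ?_
    rw [← AddChar.map_neg_eq_conj, show v - (u - y) = v + -u + y by abel,
      AddChar.map_add_eq_mul, AddChar.map_add_eq_mul]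
    ring
  simp only [h]
  rw [← Finset.expect_sum_comm]
  refine Finset.expect_congr rfl fun u _ => ?_
  rw [← Finset.expect_sum_comm]
  simp only [← Finset.mul_sum, AddChar.sum_apply_eq_ite]
  rw [Fintype.expect_eq_sum_div_card, Finset.sum_eq_single (u - y)]
  · have : (Fintype.card G : ℂ) ≠ 0 := by exact_mod_cast Fintype.card_ne_zero
    simp only [sub_self, if_true]
    field_simp
  · intro v _ hv
    rw [if_neg (sub_ne_zero.2 hv), mul_zero]
  · simp

lemma sum_norm_dft_sq (f : G → ℂ) : ∑ γ : AddChar G ℂ, ‖dft f γ‖ ^ 2 = 𝔼 x, ‖f x‖ ^ 2 := by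
  have h := diffConv_eq_sum_dft f f 0
  simp only [diffConv, sub_zero, AddChar.map_zero_eq_one, mul_one, Complex.mul_conj'] at h
  rw [Fintype.expect_eq_sum_div_card] at h ⊢
  exact_mod_cast h.symm

lemma sum_norm_dft_mul_dft_le (f g : G → ℂ) :
    ∑ γ : AddChar G ℂ, ‖dft f γ * conj (dft g γ)‖ ≤
      √(𝔼 x, ‖f x‖ ^ 2) * √(𝔼 x, ‖g x‖ ^ 2) := by
  rw [← sum_norm_dft_sq, ← sum_norm_dft_sq]
  simp only [norm_mul, RCLike.norm_conj]
  exact Real.sum_mul_le_sqrt_mul_sqrt _ _ _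

lemma diffConv_ofReal (f g : G → ℝ) (y : G) :
    diffConv (fun x => (f x : ℂ)) (fun x => (g x : ℂ)) y = ((diffConv f g y : ℝ) : ℂ) := by
  simp only [diffConv, Fintype.expect_eq_sum_div_card]
  push_cast
  simp

end Fourier

/-! ### Exponential moments -/

/-- Hoeffding's argument: by convexity `exp (t u) ≤ cosh t + u sinh t` for `|u| ≤ 1`, and the `sinh`
term has mean zero. -/
lemma expect_exp_mul_le {ι : Type*} {s : Finset ι} (hs : s.Nonempty) {u : ι → ℝ}
    (hu : ∀ i ∈ s, |u i| ≤ 1) (h0 : 𝔼 i ∈ s, u i = 0) (t : ℝ) :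
    𝔼 i ∈ s, Real.exp (t * u i) ≤ Real.exp (t ^ 2 / 2) := by
  calc 𝔼 i ∈ s, Real.exp (t * u i)
      ≤ 𝔼 i ∈ s, (Real.cosh t + u i * Real.sinh t) :=
        Finset.expect_le_expect fun i hi => by
          rw [mul_comm]; exact Real.exp_mul_le_cosh_add_mul_sinh (hu i hi) t
    _ = Real.cosh t := by
        rw [Finset.expect_add_distrib, Finset.expect_const hs, ← Finset.expect_mul, h0]; simp
    _ ≤ _ := Real.cosh_le_exp_half_sq t

/-- Jensen's inequality for the exponential function. -/
lemma exp_expect_le {ι : Type*} {s : Finset ι} (hs : s.Nonempty) (u : ι → ℝ) :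
    Real.exp (𝔼 i ∈ s, u i) ≤ 𝔼 i ∈ s, Real.exp (u i) := by
  set c := 𝔼 i ∈ s, u i with hc
  calc Real.exp c = 𝔼 i ∈ s, Real.exp c * (1 + (u i - c)) := by
        rw [← Finset.mul_expect, Finset.expect_add_distrib, Finset.expect_sub_distrib,
          Finset.expect_const hs, Finset.expect_const hs, ← hc]
        ring
    _ ≤ 𝔼 i ∈ s, Real.exp (u i) := Finset.expect_le_expect fun i _ => by
        have h := Real.add_one_le_exp (u i - c)
        calc Real.exp c * (1 + (u i - c)) ≤ Real.exp c * Real.exp (u i - c) := by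
              gcongr; linarith
          _ = Real.exp (u i) := by rw [← Real.exp_add]; congr 1; ring

lemma card_le_two_mul_card_filter {ι : Type*} {s : Finset ι} {F : ι → ℝ}
    (hF : ∀ i ∈ s, 0 ≤ F i) {c : ℝ} (hc : 0 < c) (h : 𝔼 i ∈ s, F i ≤ c)
    [DecidablePred fun i => F i ≤ 2 * c] :
    (s.card : ℝ) ≤ 2 * ((s.filter fun i => F i ≤ 2 * c).card : ℝ) := by
  rcases s.eq_empty_or_nonempty with rfl | hs
  · simp
  have hs0 : (0 : ℝ) < s.card := by exact_mod_cast hs.card_pos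
  rw [Finset.expect_eq_sum_div_card, div_le_iff₀ hs0] at h
  have h1 : (((s.filter fun i => ¬ F i ≤ 2 * c).card : ℝ)) * (2 * c) ≤ ∑ i ∈ s, F i := by
    rw [← nsmul_eq_mul, ← Finset.sum_const]
    refine (Finset.sum_le_sum fun i hi => ?_).trans
      (Finset.sum_le_sum_of_subset_of_nonneg (Finset.filter_subset _ _) fun i hi _ => hF i hi)
    exact (not_le.1 (Finset.mem_filter.1 hi).2).le
  have h2 : ((s.filter fun i => F i ≤ 2 * c).card : ℝ) +
      ((s.filter fun i => ¬ F i ≤ 2 * c).card : ℝ) = s.card := by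
    exact_mod_cast Finset.card_filter_add_card_filter_not _
  nlinarith

/-- Exponential moments of the mean of `m` independent samples of a bounded centred function. -/
lemma expect_exp_abs_sample_le {ι : Type*} {s : Finset ι} (hs : s.Nonempty) {u : ι → ℝ}
    (hu : ∀ i ∈ s, |u i| ≤ 1) (h0 : 𝔼 i ∈ s, u i = 0) {m : ℕ} (hm : 0 < m) (t : ℝ) :
    𝔼 a ∈ Fintype.piFinset (fun _ : Fin m => s), Real.exp (t * |𝔼 j, u (a j)|) ≤
      2 * Real.exp (t ^ 2 / (2 * m)) := by
  have hm' : (0 : ℝ) < m := by exact_mod_cast hm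
  have key : ∀ t : ℝ, 𝔼 a ∈ Fintype.piFinset (fun _ : Fin m => s),
      Real.exp (t * 𝔼 j, u (a j)) ≤ Real.exp (t ^ 2 / (2 * m)) := by
    intro t
    have h1 : ∀ a : Fin m → ι, Real.exp (t * 𝔼 j, u (a j)) =
        ∏ j, Real.exp (t / m * u (a j)) := by
      intro a
      rw [← Real.exp_sum, ← Finset.mul_sum, Fintype.expect_eq_sum_div_card, Fintype.card_fin]
      congr 1
      ring
    simp only [h1]
    rw [← Finset.expect_pow s (fun i => Real.exp (t / m * u i)) m]
    calc _ ≤ Real.exp ((t / m) ^ 2 / 2) ^ m :=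
          pow_le_pow_left₀ (Finset.expect_nonneg fun _ _ => (Real.exp_pos _).le)
            (expect_exp_mul_le hs hu h0 _) m
      _ = _ := by
          rw [← Real.exp_nat_mul]
          congr 1
          field_simp
  calc _ ≤ 𝔼 a ∈ Fintype.piFinset (fun _ : Fin m => s),
        (Real.exp (t * 𝔼 j, u (a j)) + Real.exp (-t * 𝔼 j, u (a j))) :=
        Finset.expect_le_expect fun a _ => by
          rcases abs_cases (𝔼 j, u (a j)) with ⟨h, _⟩ | ⟨h, _⟩
          · rw [h]; linarith [Real.exp_pos (-t * 𝔼 j, u (a j))]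
          · rw [h, mul_neg, ← neg_mul]; linarith [Real.exp_pos (t * 𝔼 j, u (a j))]
    _ ≤ _ := by
        rw [Finset.expect_add_distrib]
        have h1 := key t
        have h2 := key (-t)
        rw [neg_sq] at h2
        linarith

/-- From the exponential estimate to an estimate on average over any set that is not too small. -/
lemma expect_abs_le_of_sum_exp_le {G : Type*} [DecidableEq G] {Q Y : Finset G} (hY : Y.Nonempty) {h : G → ℝ}
    (hsupp : ∀ x, x ∉ Q → h x = 0) {α η : ℝ} {m : ℕ} (hm : 0 < m) (hη : 0 < η) (hα : 0 < α)
    (hα1 : α ≤ 1) (hQY : (Q.card : ℝ) ≤ 2 / α * Y.card)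
    (hmη : 2 * Real.log (9 / α) ≤ m * η ^ 2)
    (hexp : ∑ x ∈ Q, Real.exp (m * η * |h x|) ≤
      4 * Q.card * Real.exp ((m * η) ^ 2 / (2 * m))) :
    𝔼 x ∈ Y, |h x| ≤ η := by
  have hm' : (0 : ℝ) < m := by exact_mod_cast hm
  have hY0 : (0 : ℝ) < Y.card := by exact_mod_cast hY.card_pos
  have hE : (m * η) ^ 2 / (2 * m) = m * η ^ 2 / 2 := by field_simp
  rw [hE] at hexp
  have hE1 : 1 ≤ Real.exp (m * η ^ 2 / 2) := Real.one_le_exp (by positivity)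
  have hsum : ∑ x ∈ Y, Real.exp (m * η * |h x|) ≤
      Y.card + ∑ x ∈ Q, Real.exp (m * η * |h x|) := by
    rw [← Finset.sum_filter_add_sum_filter_not Y (· ∈ Q), add_comm]
    refine add_le_add ?_ ?_
    · have : ∀ x ∈ Y.filter (fun x => ¬ x ∈ Q), Real.exp (m * η * |h x|) = 1 := by
        intro x hx
        rw [hsupp x (Finset.mem_filter.1 hx).2]; simp
      rw [Finset.sum_congr rfl this, Finset.sum_const, nsmul_eq_mul, mul_one]
      exact_mod_cast Finset.card_filter_le _ _
    · refine Finset.sum_le_sum_of_subset_of_nonneg ?_ fun _ _ _ => (Real.exp_pos _).le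
      intro x hx; exact (Finset.mem_filter.1 hx).2
  -- Jensen's inequality on `Y`. Points of `Q` contribute `4 · 2/α` and points outside it, where `h
  -- = 0`, contribute at most `1/α`; hence `9/α`.
  have hJ : Real.exp (m * η * 𝔼 x ∈ Y, |h x|) ≤ 9 / α * Real.exp (m * η ^ 2 / 2) := by
    rw [Finset.mul_expect]
    refine (exp_expect_le hY _).trans ?_
    rw [Finset.expect_eq_sum_div_card, div_le_iff₀ hY0]
    have h1 : 4 * (Q.card : ℝ) * Real.exp (m * η ^ 2 / 2) ≤
        4 * (2 / α * Y.card) * Real.exp (m * η ^ 2 / 2) := by gcongr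
    have h2 : (Y.card : ℝ) ≤ 1 / α * Real.exp (m * η ^ 2 / 2) * Y.card := by
      have : 1 ≤ 1 / α := by rw [le_div_iff₀ hα]; linarith
      have := one_le_mul_of_one_le_of_one_le this hE1
      nlinarith
    calc _ ≤ _ := hsum.trans (add_le_add h2 (hexp.trans h1))
      _ = _ := by ring
  rw [← Real.log_le_log_iff (Real.exp_pos _) (by positivity), Real.log_exp,
    Real.log_mul (by positivity) (Real.exp_pos _).ne', Real.log_exp] at hJ
  have h3 : m * η * 𝔼 x ∈ Y, |h x| ≤ m * η * η := by nlinarith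
  exact le_of_mul_le_mul_left h3 (by positivity)

/-! ### Almost periodicity -/

section AlmostPeriods

variable {G : Type*} [AddCommGroup G] [DecidableEq G]

/-- A random sample of `A` of size `m` is, with probability at least `1 / 2`, such that the
corresponding empirical mean of the shifts of `1_S` approximates the true mean in the exponential
sense. -/
lemma card_good_samples {A : Finset G} (hA : A.Nonempty) (S : Finset G) (hS : S.Nonempty)
    {m : ℕ} (hm : 0 < m) (t : ℝ) :
    ∃ L ⊆ Fintype.piFinset (fun _ : Fin m => A), (A.card : ℝ) ^ m ≤ 2 * L.card ∧
      ∀ a ∈ L, ∑ x ∈ S + A, Real.exp (t * |𝔼 j, ind S (x - a j) - 𝔼 b ∈ A, ind S (x - b)|) ≤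
        4 * (S + A).card * Real.exp (t ^ 2 / (2 * m)) := by
  classical
  set P := Fintype.piFinset (fun _ : Fin m => A) with hP
  have hPcard : (P.card : ℝ) = (A.card : ℝ) ^ m := by simp [hP]
  set F : (Fin m → G) → ℝ := fun a =>
    ∑ x ∈ S + A, Real.exp (t * |𝔼 j, ind S (x - a j) - 𝔼 b ∈ A, ind S (x - b)|) with hF
  have : Nonempty (Fin m) := ⟨⟨0, hm⟩⟩
  have hmean : 𝔼 a ∈ P, F a ≤ 2 * (S + A).card * Real.exp (t ^ 2 / (2 * m)) := by
    rw [hF, Finset.expect_sum_comm]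
    have hx : ∀ x ∈ S + A, 𝔼 a ∈ P,
        Real.exp (t * |𝔼 j, ind S (x - a j) - 𝔼 b ∈ A, ind S (x - b)|) ≤
          2 * Real.exp (t ^ 2 / (2 * m)) := by
      intro x _
      have hg0 : 0 ≤ 𝔼 b ∈ A, ind S (x - b) := Finset.expect_nonneg fun _ _ => ind_nonneg _ _
      have hg1 : 𝔼 b ∈ A, ind S (x - b) ≤ 1 := Finset.expect_le hA fun _ _ => ind_le_one _ _
      have h := expect_exp_abs_sample_le hA
        (u := fun b => ind S (x - b) - 𝔼 b ∈ A, ind S (x - b)) (fun b _ => by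
          have h0 := ind_nonneg S (x - b)
          have h1 := ind_le_one S (x - b)
          rw [abs_le]; constructor <;> linarith)
        (by rw [Finset.expect_sub_distrib, Finset.expect_const hA, sub_self]) hm t
      simpa only [Finset.expect_sub_distrib, Fintype.expect_const] using h
    refine (Finset.sum_le_sum hx).trans (le_of_eq ?_)
    rw [Finset.sum_const, nsmul_eq_mul]
    ring
  have hQ : (0 : ℝ) < (S + A).card := by exact_mod_cast (hS.add hA).card_pos
  have h := card_le_two_mul_card_filter (F := F)
    (fun a _ => Finset.sum_nonneg fun _ _ => (Real.exp_pos _).le) (by positivity) hmean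
  refine ⟨P.filter fun a => F a ≤ 2 * (2 * (S + A).card * Real.exp (t ^ 2 / (2 * m))),
    Finset.filter_subset _ _, ?_, fun a ha => ?_⟩
  · rw [← hPcard]; exact h
  · exact ((Finset.mem_filter.1 ha).2).trans (le_of_eq (by ring))

/-- The Croot–Sisask lemma, in an `L¹` form that holds on all translates of sets of a given
size. -/
lemma exists_almost_periods {A T S : Finset G} (hA : A.Nonempty) (hS : S.Nonempty)
    {N m : ℕ} (hN : 0 < N) (hm : 0 < m) {α η : ℝ} (hα : 0 < α) (hα1 : α ≤ 1) (hη : 0 < η)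
    (hSA : ((S + A).card : ℝ) ≤ 2 / α * N) (hmη : 2 * Real.log (9 / α) ≤ m * η ^ 2) :
    ∃ X ⊆ T, (T.card : ℝ) * A.card ^ m ≤ 2 * X.card * (A - T).card ^ m ∧
      ∀ t ∈ X, ∀ t' ∈ X, ∀ Y : Finset G, Y.card = N →
        𝔼 x ∈ Y, |𝔼 b ∈ A, ind S (x + (t - t') - b) - 𝔼 b ∈ A, ind S (x - b)| ≤ 2 * η := by
  classical
  rcases T.eq_empty_or_nonempty with rfl | hT
  · exact ⟨∅, by simp⟩
  obtain ⟨L, hLA, hLcard, hL⟩ := card_good_samples hA S hS hm (m * η)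
  set Z := Fintype.piFinset (fun _ : Fin m => A - T) with hZ
  have hZcard : (Z.card : ℝ) = ((A - T).card : ℝ) ^ m := by simp [hZ]
  have hZne : Z.Nonempty := by
    simpa [hZ, Fintype.piFinset_nonempty] using fun _ => hA.sub hT
  -- Shifting good samples by elements of `T` lands in `(A - T)^m`, so some `z` is hit by many
  -- pairs. The corresponding shifts form `X`: for each `t ∈ X`, the sample `z + t` is good.
  set φ : (Fin m → G) × G → (Fin m → G) := fun p j => p.1 j - p.2 with hφ
  obtain ⟨z, -, hz⟩ := Finset.exists_max_image Z
    (fun z => ((L ×ˢ T).filter fun p => φ p = z).card) hZne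
  have hpig := Finset.card_le_mul_card_image_of_maps_to (f := φ) (s := L ×ˢ T) (t := Z)
    (fun p hp => by
      rw [Finset.mem_product] at hp
      exact Fintype.mem_piFinset.2 fun j =>
        Finset.sub_mem_sub (Fintype.mem_piFinset.1 (hLA hp.1) j) hp.2) _ hz
  set X := T.filter fun t => (fun j => z j + t) ∈ L with hX
  have hfib : ((L ×ˢ T).filter fun p => φ p = z).card ≤ X.card := by
    refine Finset.card_le_card_of_injOn Prod.snd ?_ ?_
    · rintro ⟨a, t⟩ hp
      simp only [Finset.mem_coe, Finset.mem_filter, Finset.mem_product] at hp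
      have : (fun j => z j + t) = a := by rw [← hp.2]; funext j; simp [hφ]
      simp only [hX, Finset.mem_coe, Finset.mem_filter, this]
      exact ⟨hp.1.2, hp.1.1⟩
    · rintro ⟨a, t⟩ hp ⟨a', t'⟩ hp' (rfl : t = t')
      simp only [Finset.mem_coe, Finset.mem_filter] at hp hp'
      have h := hp.2.trans hp'.2.symm
      have : a = a' := by
        funext j
        have := congrFun h j
        simpa [hφ] using this
      rw [this]
  refine ⟨X, Finset.filter_subset _ _, ?_, ?_⟩
  · rw [Finset.card_product] at hpig
    have h1 : (L.card : ℝ) * T.card ≤ X.card * (A - T).card ^ m := by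
      rw [← hZcard]
      exact_mod_cast hpig.trans (Nat.mul_le_mul_right _ hfib)
    have hT0 : (0 : ℝ) ≤ T.card := by positivity
    nlinarith
  · have hclose : ∀ t ∈ X, ∀ Y : Finset G, Y.card = N →
        𝔼 x ∈ Y, |𝔼 j, ind S (x - (z j + t)) - 𝔼 b ∈ A, ind S (x - b)| ≤ η := by
      intro t ht Y hY
      have htL := (Finset.mem_filter.1 ht).2
      refine expect_abs_le_of_sum_exp_le (Q := S + A)
        (h := fun x => 𝔼 j, ind S (x - (z j + t)) - 𝔼 b ∈ A, ind S (x - b))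
        (Finset.card_pos.1 (hY ▸ hN)) ?_ hm hη hα hα1 (by rw [hY]; exact hSA) hmη (hL _ htL)
      intro x hx
      have hout : ∀ b ∈ A, ind S (x - b) = 0 := by
        intro b hb
        rw [ind_apply, if_neg]
        intro hxb
        exact hx (Finset.mem_add.2 ⟨x - b, hxb, b, hb, by abel⟩)
      have h1 : 𝔼 j, ind S (x - (z j + t)) = 0 :=
        Finset.expect_eq_zero fun j _ => hout _ (Fintype.mem_piFinset.1 (hLA htL) j)
      rw [h1, Finset.expect_eq_zero hout, sub_zero]
    intro t ht t' ht' Y hY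
    have h1 := hclose t' ht' Y hY
    -- As `x + (t - t') - (z + t) = x - (z + t')`, the true means at `x + (t - t')` and at `x` are
    -- both close to the same empirical mean.
    have h2 := hclose t ht (Y.image (· + (t - t')))
      (by rw [Finset.card_image_of_injective _ (add_left_injective _), hY])
    rw [Finset.expect_image fun x _ y _ hxy => by simpa using hxy] at h2
    have h3 : ∀ x j, x + (t - t') - (z j + t) = x - (z j + t') := fun x j => by abel
    simp only [h3] at h2
    calc _ ≤ 𝔼 x ∈ Y, (|𝔼 j, ind S (x - (z j + t')) - 𝔼 b ∈ A, ind S (x + (t - t') - b)| +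
          |𝔼 j, ind S (x - (z j + t')) - 𝔼 b ∈ A, ind S (x - b)|) :=
          Finset.expect_le_expect fun x _ => by
            rw [abs_sub_comm (𝔼 j, ind S (x - (z j + t'))) (𝔼 b ∈ A, ind S (x + (t - t') - b))]
            exact abs_sub_le _ _ _
      _ ≤ 2 * η := by rw [Finset.expect_add_distrib]; linarith

end AlmostPeriods

/-! ### Chang's lemma relative to a Bohr set -/

lemma norm_expect_le_one {Ω : Type*} {s : Finset Ω} (hs : s.Nonempty) {f : Ω → ℂ}
    (hf : ∀ i ∈ s, ‖f i‖ ≤ 1) : ‖𝔼 i ∈ s, f i‖ ≤ 1 := by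
  have hs0 : (0 : ℝ) < s.card := by exact_mod_cast hs.card_pos
  rw [Finset.expect_eq_sum_div_card, norm_div, Complex.norm_natCast, div_le_one hs0]
  refine (norm_sum_le_of_le _ hf).trans ?_
  simp

lemma norm_prod_sub_one_le {ι : Type*} (s : Finset ι) {z : ι → ℂ} (hz : ∀ i ∈ s, ‖z i‖ = 1) :
    ‖∏ i ∈ s, z i - 1‖ ≤ ∑ i ∈ s, ‖z i - 1‖ := by
  classical
  induction s using Finset.induction_on with
  | empty => simp
  | insert i s hi ih =>
    rw [Finset.prod_insert hi, Finset.sum_insert hi]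
    have h := ih fun j hj => hz j (Finset.mem_insert_of_mem hj)
    have h1 : z i * ∏ j ∈ s, z j - 1 = z i * (∏ j ∈ s, z j - 1) + (z i - 1) := by ring
    rw [h1]
    refine (norm_add_le _ _).trans ?_
    rw [norm_mul, hz i (Finset.mem_insert_self _ _), one_mul]
    linarith

lemma norm_inv_sub_one {z : ℂ} (hz : ‖z‖ = 1) : ‖z⁻¹ - 1‖ = ‖z - 1‖ := by
  have h0 : z ≠ 0 := by rintro rfl; simp at hz
  have : z⁻¹ - 1 = -(z - 1) / z := by field_simp; ring
  rw [this, norm_div, hz, norm_neg, div_one]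

/-- The signs used as exponents in a dissociativity relation. -/
def signs : Finset ℤ := {-1, 0, 1}

lemma norm_zpow_sub_one_le {z : ℂ} (hz : ‖z‖ = 1) {e : ℤ} (he : e ∈ signs) :
    ‖z ^ e - 1‖ ≤ ‖z - 1‖ := by
  simp only [signs, Finset.mem_insert, Finset.mem_singleton] at he
  rcases he with rfl | rfl | rfl
  · rw [zpow_neg_one, norm_inv_sub_one hz]
  · simp
  · simp

/-! ### Riesz products, Rudin's inequality and maximal dissociated sets -/

section Rudin

variable {G : Type*} [AddCommGroup G] [Fintype G] {Ω : Type*}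

/-- The coefficients in the expansion of `cosh t + sinh t * Re (c * z)` in powers of `z`. -/
def rieszCoeff (t : ℝ) (c : ℂ) (e : ℤ) : ℂ :=
  if e = 0 then Real.cosh t else if e = 1 then Real.sinh t * c / 2 else Real.sinh t * conj c / 2

lemma sum_rieszCoeff (t : ℝ) (c : ℂ) {z : ℂ} (hz : ‖z‖ = 1) :
    ∑ e ∈ signs, rieszCoeff t c e * z ^ e = ((Real.cosh t + (c * z).re * Real.sinh t : ℝ) : ℂ) := by
  have h1 : z⁻¹ = conj z := Complex.inv_eq_conj hz
  have h2 : ((c * z).re : ℂ) = (c * z + conj (c * z)) / 2 := by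
    rw [Complex.re_eq_add_conj]
  have h3 : signs = {-1, 0, 1} := rfl
  rw [h3, Finset.sum_insert (by decide), Finset.sum_insert (by decide), Finset.sum_singleton]
  push_cast
  rw [h2]
  simp only [rieszCoeff, zpow_neg_one, h1, map_mul]
  norm_num
  ring

lemma sum_norm_rieszCoeff_le {t : ℝ} (ht : 0 ≤ t) {c : ℂ} (hc : ‖c‖ ≤ 1) :
    ∑ e ∈ signs, ‖rieszCoeff t c e‖ ≤ 2 * Real.cosh t := by
  have h3 : signs = {-1, 0, 1} := rfl
  have hs := Real.sinh_nonneg_iff.2 ht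
  have hsc := (Real.sinh_lt_cosh t).le
  have hc0 := Real.cosh_pos t
  have hnc : ‖(Real.cosh t : ℂ)‖ = Real.cosh t := by
    rw [Complex.norm_real, Real.norm_eq_abs, abs_of_pos hc0]
  have hns : ‖(Real.sinh t : ℂ)‖ = Real.sinh t := by
    rw [Complex.norm_real, Real.norm_eq_abs, abs_of_nonneg hs]
  have e1 : ‖rieszCoeff t c (-1)‖ = Real.sinh t * ‖c‖ / 2 := by
    rw [rieszCoeff, if_neg (by decide), if_neg (by decide), norm_div, norm_mul, RCLike.norm_conj,
      hns]
    norm_num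
  have e2 : ‖rieszCoeff t c 0‖ = Real.cosh t := by
    rw [rieszCoeff, if_pos rfl, hnc]
  have e3 : ‖rieszCoeff t c 1‖ = Real.sinh t * ‖c‖ / 2 := by
    rw [rieszCoeff, if_neg (by decide), if_pos rfl, norm_div, norm_mul, hns]
    norm_num
  rw [h3, Finset.sum_insert (by decide), Finset.sum_insert (by decide), Finset.sum_singleton,
    e1, e2, e3]
  nlinarith

/-- Rudin's inequality for characters that are dissociated with respect to the average over
`P w`, `w ∈ I`. -/
lemma expect_exp_le_of_dissociated {I : Finset Ω} (hI : I.Nonempty) (P : Ω → G) {ι : Type*}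
    [Fintype ι] (γ : ι → AddChar G ℂ) {c : ι → ℂ} (hc : ∀ l, ‖c l‖ ≤ 1) {θ : ℝ} (hθ0 : 0 ≤ θ)
    (hθ : ∀ p : ι → ℤ, (∀ l, p l ∈ signs) → p ≠ 0 →
      ‖𝔼 w ∈ I, (∏ l, γ l ^ p l) (P w)‖ ≤ θ)
    (hθn : θ * 2 ^ Fintype.card ι ≤ 1) {t : ℝ} (ht : 0 ≤ t) :
    𝔼 w ∈ I, Real.exp (t * ∑ l, (c l * γ l (P w)).re) ≤
      2 * Real.exp (Fintype.card ι * (t ^ 2 / 2)) := by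
  classical
  set n := Fintype.card ι
  set pi := Fintype.piFinset fun _ : ι => signs with hpi
  have h1 : ∀ w, Real.exp (t * ∑ l, (c l * γ l (P w)).re) ≤
      ∏ l, (Real.cosh t + (c l * γ l (P w)).re * Real.sinh t) := by
    intro w
    rw [Finset.mul_sum, Real.exp_sum]
    refine Finset.prod_le_prod (fun _ _ => (Real.exp_pos _).le) fun l _ => ?_
    rw [mul_comm]
    refine Real.exp_mul_le_cosh_add_mul_sinh ?_ t
    refine (Complex.abs_re_le_norm _).trans ?_
    rw [norm_mul, AddChar.norm_apply, mul_one]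
    exact hc l
  have h2 : ∀ w, ((∏ l, (Real.cosh t + (c l * γ l (P w)).re * Real.sinh t) : ℝ) : ℂ) =
      ∑ p ∈ pi, (∏ l, rieszCoeff t (c l) (p l)) * (∏ l, γ l ^ p l) (P w) := by
    intro w
    rw [Complex.ofReal_prod]
    simp only [← sum_rieszCoeff t (c _) (AddChar.norm_apply (γ _) (P w))]
    rw [Finset.prod_univ_sum]
    refine Finset.sum_congr rfl fun p _ => ?_
    rw [Finset.prod_mul_distrib, AddChar.prod_apply]
    simp only [AddChar.zpow_apply]
  have h3 : ((𝔼 w ∈ I, ∏ l, (Real.cosh t + (c l * γ l (P w)).re * Real.sinh t) : ℝ) : ℂ) =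
      ∑ p ∈ pi, (∏ l, rieszCoeff t (c l) (p l)) * 𝔼 w ∈ I, (∏ l, γ l ^ p l) (P w) := by
    simp only [Finset.mul_expect]
    rw [← Finset.expect_sum_comm]
    simp only [← h2]
    rw [Finset.expect_eq_sum_div_card, Finset.expect_eq_sum_div_card, Complex.ofReal_div,
      Complex.ofReal_sum, Complex.ofReal_natCast]
  have hzero : (0 : ι → ℤ) ∈ pi := Fintype.mem_piFinset.2 fun _ => by simp [signs]
  have hcosh := Real.cosh_pos t
  have h4 : ‖∑ p ∈ pi, (∏ l, rieszCoeff t (c l) (p l)) * 𝔼 w ∈ I, (∏ l, γ l ^ p l) (P w)‖ ≤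
      2 * Real.cosh t ^ n := by
    -- The trivial relation `p = 0` gives the main term `cosh^n`. All others together contribute at
    -- most `θ (2 cosh t)^n`, which the hypothesis on `θ 2^n` makes no larger.
    rw [← Finset.add_sum_erase _ _ hzero]
    have hA : ‖(∏ l, rieszCoeff t (c l) ((0 : ι → ℤ) l)) *
        𝔼 w ∈ I, (∏ l, γ l ^ (0 : ι → ℤ) l) (P w)‖ ≤ Real.cosh t ^ n := by
      rw [norm_mul, norm_prod]
      have e : ∀ l, ‖rieszCoeff t (c l) ((0 : ι → ℤ) l)‖ = Real.cosh t := by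
        intro l
        rw [Pi.zero_apply, rieszCoeff, if_pos rfl, Complex.norm_real, Real.norm_eq_abs,
          abs_of_pos hcosh]
      simp only [e, Finset.prod_const, Finset.card_univ]
      refine mul_le_of_le_one_right (by positivity) (norm_expect_le_one hI fun w _ => ?_)
      rw [AddChar.norm_apply]
    have hB : ‖∑ p ∈ pi.erase 0, (∏ l, rieszCoeff t (c l) (p l)) *
        𝔼 w ∈ I, (∏ l, γ l ^ p l) (P w)‖ ≤ Real.cosh t ^ n := by
      calc _ ≤ ∑ p ∈ pi.erase 0, (∏ l, ‖rieszCoeff t (c l) (p l)‖) * θ := by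
            refine norm_sum_le_of_le _ fun p hp => ?_
            rw [norm_mul, norm_prod]
            refine mul_le_mul_of_nonneg_left ?_ (Finset.prod_nonneg fun _ _ => norm_nonneg _)
            exact hθ p (Fintype.mem_piFinset.1 (Finset.mem_of_mem_erase hp))
              (Finset.ne_of_mem_erase hp)
        _ ≤ ∑ p ∈ pi, (∏ l, ‖rieszCoeff t (c l) (p l)‖) * θ :=
            Finset.sum_le_sum_of_subset_of_nonneg (Finset.erase_subset _ _) fun _ _ _ =>
              mul_nonneg (Finset.prod_nonneg fun _ _ => norm_nonneg _) hθ0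
        _ = (∏ l, ∑ e ∈ signs, ‖rieszCoeff t (c l) e‖) * θ := by
            rw [← Finset.sum_mul, Finset.prod_univ_sum]
        _ ≤ (∏ _l : ι, 2 * Real.cosh t) * θ := by
            gcongr with l _
            exact sum_norm_rieszCoeff_le ht (hc l)
        _ = Real.cosh t ^ n * (θ * 2 ^ n) := by
            rw [Finset.prod_const, Finset.card_univ, mul_pow]; ring
        _ ≤ _ := mul_le_of_le_one_right (by positivity) hθn
    exact (norm_add_le _ _).trans (by linarith)
  calc _ ≤ 𝔼 w ∈ I, ∏ l, (Real.cosh t + (c l * γ l (P w)).re * Real.sinh t) :=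
        Finset.expect_le_expect fun w _ => h1 w
    _ ≤ ‖((𝔼 w ∈ I, ∏ l, (Real.cosh t + (c l * γ l (P w)).re * Real.sinh t) : ℝ) : ℂ)‖ := by
        rw [Complex.norm_real]; exact le_abs_self _
    _ ≤ 2 * Real.cosh t ^ n := by rw [h3]; exact h4
    _ ≤ _ := by
        rw [Real.exp_nat_mul]
        gcongr
        exact Real.cosh_le_exp_half_sq t

/-- A family of dissociated characters with large Fourier coefficients at `μ_X` is small. -/
lemma card_le_of_dissociated {I : Finset Ω} (hI : I.Nonempty) (P : Ω → G) {X : Finset G}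
    (hX : X.Nonempty) {K : ℝ} (hK : 0 < K)
    (hdom : ∀ f : G → ℝ, (∀ x, 0 ≤ f x) → 𝔼 x ∈ X, f x ≤ K * 𝔼 w ∈ I, f (P w))
    {ι : Type*} [Fintype ι] (γ : ι → AddChar G ℂ) {θ : ℝ} (hθ0 : 0 ≤ θ)
    (hθ : ∀ p : ι → ℤ, (∀ l, p l ∈ signs) → p ≠ 0 →
      ‖𝔼 w ∈ I, (∏ l, γ l ^ p l) (P w)‖ ≤ θ)
    (hθn : θ * 2 ^ Fintype.card ι ≤ 1) (hγ : ∀ l, 1 / 2 ≤ ‖𝔼 x ∈ X, γ l x‖) :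
    (Fintype.card ι : ℝ) ≤ 8 * Real.log (2 * K) := by
  set n := Fintype.card ι
  set z : ι → ℂ := fun l => 𝔼 x ∈ X, γ l x with hz
  -- Phases that make each mean of `c l * γ l` over `X` equal to `‖z l‖`.
  set c : ι → ℂ := fun l => conj (z l) / ‖z l‖ with hcdef
  have hz0 : ∀ l, (0 : ℝ) < ‖z l‖ := fun l => lt_of_lt_of_le (by norm_num) (hγ l)
  have hc : ∀ l, ‖c l‖ ≤ 1 := fun l => by
    rw [hcdef, norm_div, RCLike.norm_conj, Complex.norm_real, norm_norm, div_self (hz0 l).ne']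
  have hre : ∀ l, 𝔼 x ∈ X, (c l * γ l x).re = ‖z l‖ := by
    intro l
    have h1 : ((𝔼 x ∈ X, c l * γ l x : ℂ)).re = 𝔼 x ∈ X, (c l * γ l x).re := by
      rw [Finset.expect_eq_sum_div_card, Finset.expect_eq_sum_div_card, Complex.div_natCast_re,
        Complex.re_sum]
    rw [← h1, ← Finset.mul_expect]
    change (conj (z l) / (‖z l‖ : ℂ) * z l).re = ‖z l‖
    have h2 : conj (z l) / (‖z l‖ : ℂ) * z l = (‖z l‖ : ℂ) := by
      have h3 : (‖z l‖ : ℂ) ≠ 0 := by exact_mod_cast (hz0 l).ne'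
      rw [div_mul_eq_mul_div, mul_comm, Complex.mul_conj', div_eq_iff h3]
      ring
    rw [h2, Complex.ofReal_re]
  have hmean : (n : ℝ) / 4 ≤ 𝔼 x ∈ X, 1 / 2 * ∑ l, (c l * γ l x).re := by
    rw [← Finset.mul_expect, Finset.expect_sum_comm]
    simp only [hre]
    have : (n : ℝ) * (1 / 2) ≤ ∑ l, ‖z l‖ := by
      have := Finset.sum_le_sum fun l (_ : l ∈ Finset.univ) => hγ l
      simpa [n] using this
    linarith
  -- Rudin's inequality with `t = 1/2` compares `n/4` with `log (2K) + n/8`.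
  have h1 : Real.exp (n / 4) ≤ K * (2 * Real.exp (n * ((1 / 2) ^ 2 / 2))) := by
    calc Real.exp (n / 4) ≤ Real.exp (𝔼 x ∈ X, 1 / 2 * ∑ l, (c l * γ l x).re) :=
          Real.exp_le_exp.2 hmean
      _ ≤ 𝔼 x ∈ X, Real.exp (1 / 2 * ∑ l, (c l * γ l x).re) := exp_expect_le hX _
      _ ≤ K * 𝔼 w ∈ I, Real.exp (1 / 2 * ∑ l, (c l * γ l (P w)).re) :=
          hdom _ fun x => (Real.exp_pos _).le
      _ ≤ _ := by
          gcongr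
          exact expect_exp_le_of_dissociated hI P γ hc hθ0 hθ hθn (by norm_num)
  have h2 := Real.log_le_log (Real.exp_pos _) h1
  rw [Real.log_exp, ← mul_assoc, Real.log_mul (by positivity) (Real.exp_pos _).ne',
    Real.log_exp, mul_comm K] at h2
  linarith

/-- All characters with large Fourier coefficient at `μ_X` are controlled by few of them, up to
characters that are not nearly orthogonal to the average over `P w`, `w ∈ I`. -/
lemma exists_small_controlling_set {I : Finset Ω} (hI : I.Nonempty) (P : Ω → G) {X : Finset G}
    (hX : X.Nonempty) {K : ℝ} (hK : 0 < K)
    (hdom : ∀ f : G → ℝ, (∀ x, 0 ≤ f x) → 𝔼 x ∈ X, f x ≤ K * 𝔼 w ∈ I, f (P w))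
    {N : ℕ} (hN0 : 0 < N) (hN : 8 * Real.log (2 * K) < N) :
    ∃ Λ : Finset (AddChar G ℂ), Λ.card < N ∧
      ∀ γ : AddChar G ℂ, 1 / 2 ≤ ‖𝔼 x ∈ X, γ x‖ →
        ∃ ψ : AddChar G ℂ, (1 / 2) ^ N < ‖𝔼 w ∈ I, ψ (P w)‖ ∧
          ∀ t, ‖γ t - 1‖ ≤ ‖ψ t - 1‖ + ∑ χ ∈ Λ, ‖χ t - 1‖ := by
  classical
  let diss : Finset (AddChar G ℂ) → Prop := fun Λ => ∀ p : AddChar G ℂ → ℤ,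
    (∀ χ, p χ ∈ signs) → (∃ χ ∈ Λ, p χ ≠ 0) → ‖𝔼 w ∈ I, (∏ χ ∈ Λ, χ ^ p χ) (P w)‖ ≤ (1 / 2) ^ N
  set Spec : Finset (AddChar G ℂ) := Finset.univ.filter fun γ => 1 / 2 ≤ ‖𝔼 x ∈ X, γ x‖
    with hSpec
  have hsub : ∀ {Λ Λ' : Finset (AddChar G ℂ)}, Λ' ⊆ Λ → diss Λ → diss Λ' := by
    rintro Λ Λ' hΛ h p hp ⟨χ, hχ, hpχ⟩
    have := h (fun χ => if χ ∈ Λ' then p χ else 0)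
      (fun χ => by split_ifs; exacts [hp χ, by simp [signs]])
      ⟨χ, hΛ hχ, by simpa [hχ] using hpχ⟩
    have e : ∏ χ ∈ Λ, χ ^ (if χ ∈ Λ' then p χ else 0) = ∏ χ ∈ Λ', χ ^ p χ := by
      rw [← Finset.prod_subset hΛ]
      · exact Finset.prod_congr rfl fun χ hχ => by rw [if_pos hχ]
      · intro χ _ hχ; rw [if_neg hχ, zpow_zero]
    rwa [e] at this
  have hsmall : ∀ Λ ⊆ Spec, diss Λ → Λ.card < N := by
    intro Λ hΛ hd
    by_contra! hcard
    -- A subset of size exactly `N` is taken so that the threshold `(1/2)^N` balances the `2^N` in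
    -- Rudin's inequality.
    obtain ⟨Λ', hΛ', hcard'⟩ := Finset.exists_subset_card_eq hcard
    have hd' := hsub hΛ' hd
    have := card_le_of_dissociated hI P hX hK hdom (ι := Λ') (fun l => (l : AddChar G ℂ))
      (θ := (1 / 2) ^ N) (by positivity) (fun p hp hp0 => by
        obtain ⟨l, hl⟩ := Function.ne_iff.1 hp0
        have := hd' (fun χ => if h : χ ∈ Λ' then p ⟨χ, h⟩ else 0)
          (fun χ => by split_ifs; exacts [hp _, by simp [signs]])
          ⟨l, l.2, by simpa using hl⟩
        rw [← Finset.prod_coe_sort] at this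
        simpa using this)
      (by rw [Fintype.card_coe, hcard', ← mul_pow]; norm_num)
      (fun l => (Finset.mem_filter.1 (hΛ (hΛ' l.2))).2)
    rw [Fintype.card_coe, hcard'] at this
    linarith
  obtain ⟨Λ, hΛ, hmax⟩ := Finset.exists_max_image (Spec.powerset.filter diss) Finset.card
    ⟨∅, by simp [diss]⟩
  rw [Finset.mem_filter, Finset.mem_powerset] at hΛ
  refine ⟨Λ, hsmall Λ hΛ.1 hΛ.2, fun γ hγ => ?_⟩
  by_cases hγΛ : γ ∈ Λ
  · refine ⟨1, ?_, fun t => ?_⟩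
    · simp only [AddChar.one_apply, Finset.expect_const hI, norm_one]
      exact pow_lt_one₀ (by norm_num) (by norm_num) hN0.ne'
    · rw [AddChar.one_apply, sub_self, norm_zero, zero_add]
      exact Finset.single_le_sum (f := fun χ : AddChar G ℂ => ‖χ t - 1‖)
        (fun _ _ => norm_nonneg _) hγΛ
  -- By maximality of `Λ`, adding `γ` creates a relation with large mean. It must involve `γ`, since
  -- `Λ` is dissociated; its product is the required `ψ`, and solving for `γ` expresses it through
  -- `ψ` and `Λ`.
  · have hnot : ¬ diss (insert γ Λ) := by
      intro hd
      have := hmax (insert γ Λ) (Finset.mem_filter.2 ⟨Finset.mem_powerset.2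
        (Finset.insert_subset (Finset.mem_filter.2 ⟨Finset.mem_univ _, hγ⟩) hΛ.1), hd⟩)
      rw [Finset.card_insert_of_notMem hγΛ] at this
      omega
    simp only [diss] at hnot
    push Not at hnot
    obtain ⟨p, hp, ⟨χ, hχ, hpχ⟩, hlarge⟩ := hnot
    rw [Finset.prod_insert hγΛ] at hlarge
    have hpγ : p γ ≠ 0 := by
      intro h0
      rw [h0, zpow_zero, one_mul] at hlarge
      refine absurd (hΛ.2 p hp ⟨χ, ?_, hpχ⟩) (not_le.2 hlarge)
      rcases Finset.mem_insert.1 hχ with rfl | h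
      · exact absurd h0 hpχ
      · exact h
    refine ⟨_, hlarge, fun t => ?_⟩
    set b := ∏ χ ∈ Λ, (χ t) ^ p χ with hb
    have hb1 : ‖b‖ = 1 := by
      rw [hb, norm_prod]
      exact Finset.prod_eq_one fun χ _ => by rw [norm_zpow, AddChar.norm_apply, one_zpow]
    have hbt : ‖b - 1‖ ≤ ∑ χ ∈ Λ, ‖χ t - 1‖ :=
      (norm_prod_sub_one_le Λ fun χ _ => by rw [norm_zpow, AddChar.norm_apply, one_zpow]).trans
        (Finset.sum_le_sum fun χ _ => norm_zpow_sub_one_le (AddChar.norm_apply χ t) (hp χ))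
    have hψ : (γ ^ p γ * ∏ χ ∈ Λ, χ ^ p χ) t = γ t ^ p γ * b := by
      rw [AddChar.mul_apply, AddChar.zpow_apply, AddChar.prod_apply]
      simp only [AddChar.zpow_apply, hb]
    rw [hψ]
    have hγt : ‖γ t ^ p γ - 1‖ = ‖γ t - 1‖ := by
      have := hp γ
      simp only [signs, Finset.mem_insert, Finset.mem_singleton] at this
      rcases this with h | h | h
      · rw [h, zpow_neg_one, norm_inv_sub_one (AddChar.norm_apply γ t)]
      · exact absurd h hpγ
      · rw [h, zpow_one]
    have hn : ‖γ t ^ p γ‖ = 1 := by rw [norm_zpow, AddChar.norm_apply, one_zpow]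
    rw [← hγt]
    have e : γ t ^ p γ - 1 = (γ t ^ p γ * b - 1) - γ t ^ p γ * (b - 1) := by ring
    rw [e]
    refine (norm_sub_le _ _).trans ?_
    rw [norm_mul, hn, one_mul]
    linarith

end Rudin

/-! ### Large spectrum of a dense subset of a regular Bohr set -/

section LocalChang

variable {G : Type*} [AddCommGroup G] [Fintype G]

lemma sum_mem_bohr {Γ : Finset (AddChar G ℂ)} {r : ℝ} {n : ℕ} {s : Fin n → G}
    (hs : ∀ j, s j ∈ bohr Γ r) : ∑ j, s j ∈ bohr Γ (n * r) := by
  induction n with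
  | zero => simpa using zero_mem_bohr (Γ := Γ) (le_refl (0 : ℝ))
  | succ n ih =>
    rw [Fin.sum_univ_succ]
    have := add_mem_bohr (hs 0) (ih fun j => hs j.succ)
    convert this using 2
    push_cast
    ring

/-- Chang's lemma relative to a regular Bohr set. -/
lemma local_chang {Γ : Finset (AddChar G ℂ)} (hΓ : Γ.Nonempty) {ρ r : ℝ} (hρ : 0 ≤ ρ)
    (hr : 0 ≤ r) (hregρ : IsRegularBohr Γ ρ) (hregr : IsRegularBohr Γ r) {X : Finset G}
    (hX : X.Nonempty) (hXT : X ⊆ bohr Γ ρ) {N : ℕ} (hN0 : 0 < N)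
    (hN : 8 * Real.log (4 * ((bohr Γ ρ).card / X.card)) < N)
    (hrN : N * r ≤ 1 / (100 * (Γ.card : ℝ)) * ρ) :
    ∃ Λ : Finset (AddChar G ℂ), Λ.card < N ∧
      ∀ γ : AddChar G ℂ, 1 / 2 ≤ ‖𝔼 x ∈ X, γ x‖ →
        ∀ δ : ℝ, 0 < δ → δ ≤ 1 / (100 * (Γ.card : ℝ)) → ∀ t ∈ bohr Γ (δ * r),
          ‖γ t - 1‖ ≤ 400 * δ * Γ.card + ∑ χ ∈ Λ, ‖χ t - 1‖ := by
  classical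
  set T := bohr Γ ρ with hT
  set T' := bohr Γ ((1 + 1 / (100 * (Γ.card : ℝ))) * ρ) with hT'
  set R := bohr Γ r with hR
  have hT'card : (T'.card : ℝ) ≤ 2 * T.card := hregρ.card_dilate_le hΓ
  have hT'ne : T'.Nonempty := bohr_nonempty (by positivity)
  have hRne : R.Nonempty := bohr_nonempty hr
  have hT0 : (0 : ℝ) < T.card := bohr_card_pos Γ hρ
  have hX0 : (0 : ℝ) < X.card := by exact_mod_cast hX.card_pos
  have hT'0 : (0 : ℝ) < T'.card := by exact_mod_cast hT'ne.card_pos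
  have hR0 : (0 : ℝ) < R.card := by exact_mod_cast hRne.card_pos
  -- The reference measure is `μ_{T'}` convolved with `N` copies of `μ_R`. It dominates `μ_T` up to
  -- a factor 2, because `T` minus any sum of `N` elements of `R` stays in `T'`; the `N` copies turn
  -- a mean above `(1/2)^N` into a mean of at least `1/2` over `R`.
  set I := T' ×ˢ Fintype.piFinset (fun _ : Fin N => R) with hI
  set P : G × (Fin N → G) → G := fun w => w.1 + ∑ j, w.2 j with hP
  have hIne : I.Nonempty :=
    hT'ne.product (Fintype.piFinset_nonempty.2 fun _ => hRne)
  have hdom : ∀ f : G → ℝ, (∀ x, 0 ≤ f x) →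
      𝔼 x ∈ X, f x ≤ 2 * (T.card / X.card) * 𝔼 w ∈ I, f (P w) := by
    intro f hf
    have h1 : ∀ s ∈ Fintype.piFinset (fun _ : Fin N => R),
        (∑ x ∈ T, f x) / T'.card ≤ 𝔼 y ∈ T', f (P (y, s)) := by
      intro s hs
      rw [Finset.expect_eq_sum_div_card]
      gcongr
      have himg : ∑ y ∈ T', f (P (y, s)) = ∑ x ∈ T'.image (· + ∑ j, s j), f x := by
        rw [Finset.sum_image fun x _ y _ hxy => by simpa using hxy]
      rw [himg]
      refine Finset.sum_le_sum_of_subset_of_nonneg (fun x hx => ?_) fun x _ _ => hf x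
      refine Finset.mem_image.2 ⟨x - ∑ j, s j, ?_, by simp⟩
      refine bohr_mono Γ ?_ (sub_mem_bohr hx (sum_mem_bohr (Fintype.mem_piFinset.1 hs)))
      linarith
    have h2 : (∑ x ∈ T, f x) / T'.card ≤ 𝔼 w ∈ I, f (P w) := by
      rw [hI, Finset.expect_product, Finset.expect_comm]
      exact Finset.le_expect (Fintype.piFinset_nonempty.2 fun _ => hRne) h1
    have h3 : ∑ x ∈ X, f x ≤ ∑ x ∈ T, f x :=
      Finset.sum_le_sum_of_subset_of_nonneg hXT fun x _ _ => hf x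
    have h4 : 0 ≤ ∑ x ∈ T, f x := Finset.sum_nonneg fun x _ => hf x
    have h5 : 0 ≤ 𝔼 w ∈ I, f (P w) := Finset.expect_nonneg fun w _ => hf _
    rw [div_le_iff₀ hT'0] at h2
    rw [Finset.expect_eq_sum_div_card, div_le_iff₀ hX0]
    calc ∑ x ∈ X, f x ≤ (𝔼 w ∈ I, f (P w)) * T'.card := h3.trans h2
      _ ≤ (𝔼 w ∈ I, f (P w)) * (2 * T.card) := by gcongr
      _ = _ := by field_simp
  obtain ⟨Λ, hΛ, hspec⟩ := exists_small_controlling_set hIne P hX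
    (K := 2 * (T.card / X.card)) (by positivity) hdom hN0
    (by rwa [← mul_assoc, show (2 : ℝ) * 2 = 4 by norm_num])
  refine ⟨Λ, hΛ, fun γ hγ δ hδ hδ' t ht => ?_⟩
  obtain ⟨ψ, hψ, hγψ⟩ := hspec γ hγ
  refine (hγψ t).trans (add_le_add ?_ le_rfl)
  have hfac : 𝔼 w ∈ I, ψ (P w) = (𝔼 y ∈ T', ψ y) * (𝔼 s ∈ R, ψ s) ^ N := by
    rw [hI, Finset.expect_product, Finset.expect_pow, Finset.expect_mul]
    refine Finset.expect_congr rfl fun y _ => ?_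
    rw [Finset.mul_expect]
    refine Finset.expect_congr rfl fun s _ => ?_
    rw [hP, AddChar.map_add_eq_mul]
    congr 1
    exact map_sum ψ.toAddMonoidHom s Finset.univ
  have hbig : 1 / 2 ≤ ‖𝔼 s ∈ R, ψ s‖ := by
    by_contra! hlt
    rw [hfac, norm_mul, norm_pow] at hψ
    have h1 : ‖𝔼 y ∈ T', ψ y‖ ≤ 1 :=
      norm_expect_le_one hT'ne fun y _ => (AddChar.norm_apply ψ y).le
    have h2 : ‖𝔼 s ∈ R, ψ s‖ ^ N ≤ (1 / 2) ^ N := by gcongr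
    have h3 : 0 ≤ ‖𝔼 s ∈ R, ψ s‖ ^ N := by positivity
    nlinarith
  have hshift := hregr.norm_sum_shift_sub_le hδ hδ' ht (ψ := ψ)
    fun x => (AddChar.norm_apply ψ x).le
  -- Translation by `t` multiplies the sum of `ψ` over `R` by `ψ t`. The sum is large and regularity
  -- makes it nearly invariant, so `ψ t` is close to 1.
  have e : ∑ x ∈ R, ψ (x + t) - ∑ x ∈ R, ψ x = (ψ t - 1) * ∑ x ∈ R, ψ x := by
    simp only [AddChar.map_add_eq_mul]
    rw [← Finset.sum_mul]
    ring
  rw [← hR, e, norm_mul] at hshift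
  rw [Finset.expect_eq_sum_div_card, norm_div, Complex.norm_natCast, le_div_iff₀ hR0] at hbig
  have h1 : ‖ψ t - 1‖ * (1 / 2 * R.card) ≤ 200 * δ * Γ.card * R.card :=
    (mul_le_mul_of_nonneg_left hbig (norm_nonneg _)).trans hshift
  have h2 : ‖ψ t - 1‖ * R.card ≤ (400 * δ * Γ.card) * R.card := by linarith
  exact le_of_mul_le_mul_right h2 hR0

/-- The characters with large Fourier coefficient at `μ_X` are almost constant on a regular Bohr
set of not much larger rank and not much smaller width. -/
lemma exists_bohr_annihilating [DecidableEq (AddChar G ℂ)] {Γ : Finset (AddChar G ℂ)}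
    (hΓ : Γ.Nonempty) {ρ : ℝ} (hρ : 0 ≤ ρ) (hρ2 : ρ ≤ 2) (hreg : IsRegularBohr Γ ρ)
    {X : Finset G} (hX : X.Nonempty) (hXT : X ⊆ bohr Γ ρ) {N : ℕ} (hN0 : 0 < N)
    (hN : 8 * Real.log (4 * ((bohr Γ ρ).card / X.card)) < N) {ν : ℝ} (hν : 0 < ν) (hν1 : ν ≤ 1) :
    ∃ (Δ : Finset (AddChar G ℂ)) (ρ' : ℝ), Δ.Nonempty ∧ Δ.card ≤ N ∧ 0 ≤ ρ' ∧
      ρ * ν / (720000 * (Γ.card : ℝ) ^ 2 * Δ.card) ≤ ρ' ∧ IsRegularBohr (Γ ∪ Δ) ρ' ∧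
      ∀ γ : AddChar G ℂ, 1 / 2 ≤ ‖𝔼 x ∈ X, γ x‖ → ∀ t ∈ bohr (Γ ∪ Δ) ρ', ‖γ t - 1‖ ≤ ν := by
  have hd : (1 : ℝ) ≤ Γ.card := by exact_mod_cast hΓ.card_pos
  have hN1 : (1 : ℝ) ≤ N := by exact_mod_cast hN0
  set d : ℝ := (Γ.card : ℝ) with hddef
  -- If the dual group has at most `N` elements, all of it serves as `Δ`, and the Bohr set is `{0}`.
  rcases le_or_gt (Fintype.card (AddChar G ℂ)) N with hcard | hcard
  · set D := Fintype.card (AddChar G ℂ) with hD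
    have hD1 : (1 : ℝ) ≤ D := by exact_mod_cast (Fintype.card_pos : 0 < D)
    set ρ' := ρ * ν / (720000 * d ^ 2 * D) with hρ'
    have hρ'0 : 0 ≤ ρ' := by positivity
    have hρ'1 : ρ' ≤ 1 / 4 := by
      rw [hρ', div_le_iff₀ (by positivity)]
      have h1 : ρ * ν ≤ 2 * 1 := by gcongr
      have h2 : 1 ≤ d ^ 2 * D := one_le_mul_of_one_le_of_one_le (one_le_pow₀ hd) hD1
      nlinarith
    have hun : Γ ∪ Finset.univ = Finset.univ := Finset.union_eq_right.2 (Finset.subset_univ _)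
    refine ⟨Finset.univ, ρ', Finset.univ_nonempty, by rwa [Finset.card_univ], hρ'0, ?_, ?_, ?_⟩
    · rw [Finset.card_univ]
    · rw [hun]
      intro δ hδ hδ'
      have hδ1 : δ ≤ 1 := by
        refine hδ'.trans ?_
        rw [Finset.card_univ, div_le_one (by positivity)]
        linarith
      rw [bohr_univ_eq_singleton hρ'0 (by linarith), bohr_univ_eq_singleton (by nlinarith)
        (by nlinarith), bohr_univ_eq_singleton (by nlinarith) (by nlinarith)]
      have : 0 ≤ 100 * δ * ((Finset.univ : Finset (AddChar G ℂ)).card : ℝ) := by positivity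
      simp only [Finset.card_singleton, Nat.cast_one, mul_one, le_refl, true_and]
      constructor <;> linarith
    · intro γ _ t ht
      rw [hun, bohr_univ_eq_singleton hρ'0 (by linarith), Finset.mem_singleton] at ht
      simp [ht, hν.le]
  · obtain ⟨r, hr1, hr2, hregr⟩ := exists_isRegularBohr hΓ
      (w := ρ / (100 * d * N)) (by positivity)
    have hr0 : 0 ≤ r := le_trans (by positivity) hr1
    have hwN : N * (ρ / (100 * d * N)) = 1 / (100 * d) * ρ := by field_simp
    have hw0 : 0 ≤ ρ / (100 * d * N) := by positivity
    have hNr : N * r ≤ 1 / (100 * d) * ρ := by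
      rw [← hwN]; gcongr; linarith
    obtain ⟨Λ, hΛ, hspec⟩ := local_chang hΓ hρ hr0 hreg hregr hX hXT hN0 hN hNr
    -- Padding to exactly `N` characters matters: the width obtained has `N` in its denominator,
    -- while the required bound has `Δ.card`.
    obtain ⟨Δ, hΛΔ, hΔ⟩ := Finset.exists_superset_card_eq hΛ.le hcard.le
    -- Then the term `400δd` of Chang's lemma is `ν/2`, and the sum over `Λ` is at most `ν/400`. The
    -- constant is `720000 = 800 · 100 · 3 · 3`, with one factor 3 for each choice of a regular
    -- dilate.
    set δ := ν / (800 * d) with hδ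
    have hδ0 : 0 < δ := by positivity
    have hδd : δ * d = ν / 800 := by rw [hδ]; field_simp
    have hδ' : δ ≤ 1 / (100 * d) := by
      rw [le_div_iff₀ (by positivity)]
      linarith
    have hne : (Γ ∪ Δ).Nonempty := hΓ.mono Finset.subset_union_left
    obtain ⟨ρ', h1, h2, hreg'⟩ := exists_isRegularBohr hne (w := δ * r) (by positivity)
    have hδr : 0 ≤ δ * r := by positivity
    refine ⟨Δ, ρ', Finset.card_pos.1 (hΔ ▸ hN0), hΔ.le, le_trans (by positivity) h1, ?_, hreg',
      ?_⟩
    · rw [hΔ]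
      calc ρ * ν / (720000 * d ^ 2 * N) = δ * (ρ / (100 * d * N) / 3) / 3 := by
            rw [hδ]; field_simp; ring
        _ ≤ δ * r / 3 := by gcongr
        _ ≤ ρ' := h1
    · intro γ hγ t ht
      have htΓ : t ∈ bohr Γ (δ * r) :=
        bohr_mono Γ (by linarith) (bohr_anti Finset.subset_union_left _ ht)
      refine (hspec γ hγ δ hδ0 hδ' t htΓ).trans ?_
      have hsum : ∑ χ ∈ Λ, ‖χ t - 1‖ ≤ N * (δ * r) := by
        calc ∑ χ ∈ Λ, ‖χ t - 1‖ ≤ ∑ _χ ∈ Λ, δ * r := Finset.sum_le_sum fun χ hχ =>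
              (mem_bohr.1 ht χ (Finset.mem_union_right _ (hΛΔ hχ))).trans (by linarith)
          _ = Λ.card * (δ * r) := by rw [Finset.sum_const, nsmul_eq_mul]
          _ ≤ N * (δ * r) := by gcongr
      have hNr2 : N * r ≤ 2 := by
        refine hNr.trans ?_
        rw [one_div_mul_eq_div, div_le_iff₀ (by positivity)]
        linarith
      have hδ1 : δ ≤ ν / 800 := by rw [← hδd]; nlinarith
      have h3 : N * (δ * r) ≤ ν / 800 * 2 := by
        calc N * (δ * r) = δ * (N * r) := by ring
          _ ≤ _ := by gcongr
      have h4 : 400 * δ * d = ν / 2 := by rw [mul_assoc, hδd]; ring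
      linarith

end LocalChang

/-! ### Choice of parameters -/

lemma logFactor_ge {x : ℝ} (hx : 0 < x) (hx1 : x ≤ 1) : Real.log 2 ≤ logFactor x := by
  refine Real.log_le_log (by norm_num) ?_
  rw [le_div_iff₀ hx]
  linarith

lemma half_le_logFactor {x : ℝ} (hx : 0 < x) (hx1 : x ≤ 1) : 1 / 2 ≤ logFactor x := by
  have := logFactor_ge hx hx1
  have := Real.log_two_gt_d9
  linarith

/-- With `k = ⌈log (64/σ)⌉`, `64/σ ≤ e^k ≤ 4^k`: characters with mean below `1/2` are damped to
accuracy `σ/32`. -/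
lemma exists_iteration_count {σ : ℝ} (hσ : 0 < σ) (hσ1 : σ ≤ 1) :
    ∃ k : ℕ, 0 < k ∧ 2 * (1 / 4 : ℝ) ^ k ≤ σ / 32 ∧ (k : ℝ) ≤ 8 * logFactor σ := by
  have hL := logFactor_ge hσ hσ1
  have hL2 := half_le_logFactor hσ hσ1
  have hlog : Real.log (64 / σ) = 5 * Real.log 2 + logFactor σ := by
    rw [logFactor, show (64 : ℝ) / σ = 2 ^ 5 * (2 / σ) by ring,
      Real.log_mul (by norm_num) (by positivity), Real.log_pow]
    norm_num
  have hpos : 0 < Real.log (64 / σ) := by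
    rw [hlog]; linarith [Real.log_two_gt_d9]
  refine ⟨⌈Real.log (64 / σ)⌉₊, Nat.ceil_pos.2 hpos, ?_, ?_⟩
  · set k := ⌈Real.log (64 / σ)⌉₊
    have h1 : 64 / σ ≤ 4 ^ k := by
      calc 64 / σ = Real.exp (Real.log (64 / σ)) := (Real.exp_log (by positivity)).symm
        _ ≤ Real.exp (k * 1) := by
            rw [mul_one]; exact Real.exp_le_exp.2 (Nat.le_ceil _)
        _ = Real.exp 1 ^ k := Real.exp_nat_mul _ _
        _ ≤ 4 ^ k := by
            gcongr
            linarith [Real.exp_one_lt_d9]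
    rw [div_le_iff₀ hσ] at h1
    rw [div_pow, one_pow, mul_one_div, div_le_iff₀ (by positivity)]
    linarith
  · have := (Nat.ceil_lt_add_one hpos.le).le
    rw [hlog] at this ⊢
    linarith

lemma exists_sample_size {α η : ℝ} (hα : 0 < α) (hα1 : α ≤ 1) (hη : 0 < η) (hη1 : η ≤ 1) :
    ∃ m : ℕ, 0 < m ∧ 2 * Real.log (9 / α) ≤ m * η ^ 2 ∧ (m : ℝ) ≤ 10 * logFactor α / η ^ 2 := by
  have hL := half_le_logFactor hα hα1
  have hη2 : η ^ 2 ≤ 1 := pow_le_one₀ hη.le hη1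
  have hη0 : 0 < η ^ 2 := by positivity
  have hpos : 0 < 8 * logFactor α / η ^ 2 := by positivity
  refine ⟨⌈8 * logFactor α / η ^ 2⌉₊, Nat.ceil_pos.2 hpos, ?_, ?_⟩
  · have h1 := Nat.le_ceil (8 * logFactor α / η ^ 2)
    rw [div_le_iff₀ hη0] at h1
    have h2 : Real.log (9 / α) ≤ 4 * logFactor α := by
      have h3 : (4 : ℝ) * logFactor α = Real.log ((2 / α) ^ 4) := by
        rw [Real.log_pow, logFactor]; norm_num
      rw [h3]
      refine Real.log_le_log (by positivity) ?_
      rw [div_pow, div_le_div_iff₀ hα (by positivity)]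
      have : α ^ 4 ≤ α := by
        calc α ^ 4 = α ^ 3 * α := by ring
          _ ≤ 1 * α := by gcongr; exact pow_le_one₀ hα.le hα1
          _ = α := one_mul _
      nlinarith
    linarith
  · have h1 := (Nat.ceil_lt_add_one hpos.le).le
    refine h1.trans ?_
    rw [le_div_iff₀ hη0, add_mul, div_mul_cancel₀ _ hη0.ne']
    linarith

/-! ### Averaging `μ_{A₁} ∘ μ_{A₂}` over almost periods -/

/-- Averaging over differences of almost periods hardly changes the mass that
`μ_{A₁} ∘ μ_{A₂}` gives to `S`. -/
lemma le_expect_shiftAvg_iterate_ind {G : Type*} [AddCommGroup G] {A₁ A₂ X S : Finset G} (hX : X.Nonempty) {η : ℝ}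
    (hper : ∀ t ∈ X, ∀ t' ∈ X, ∀ Y : Finset G, Y.card = A₁.card →
      𝔼 x ∈ Y, |𝔼 b ∈ A₂, ind S (x + (t - t') - b) - 𝔼 b ∈ A₂, ind S (x - b)| ≤ 2 * η) (k : ℕ) :
    (𝔼 a ∈ A₁, 𝔼 b ∈ A₂, ind S (a - b)) - k * (2 * η) ≤
      𝔼 a ∈ A₁, 𝔼 b ∈ A₂, (shiftAvg (X ×ˢ X) fun p => p.1 - p.2)^[k] (ind S) (a - b) := by
  classical
  -- The average over `A₂` commutes with that over `X - X`, so the `L¹` stability of this smoothed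
  -- indicator is all that is needed.
  set g : G → ℝ := shiftAvg A₂ (fun b => -b) (ind S) with hg
  have hgx : ∀ x, g x = 𝔼 b ∈ A₂, ind S (x - b) := fun x => by
    simp only [hg, shiftAvg, sub_eq_add_neg]
  have h := expect_abs_shiftAvg_iterate_sub_le (hX.product hX) (fun p => p.1 - p.2) A₁ (g := g)
    (η := 2 * η) (fun p hp u => by
      rw [Finset.mem_product] at hp
      have := hper p.1 hp.1 p.2 hp.2 (A₁.image (· + u))
        (Finset.card_image_of_injective _ (add_left_injective _))
      rw [Finset.expect_image fun x _ y _ hxy => by simpa using hxy] at this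
      simpa only [hgx] using this) k 0
  simp only [add_zero] at h
  have hcomm : ∀ a, (shiftAvg (X ×ˢ X) fun p => p.1 - p.2)^[k] g a =
      𝔼 b ∈ A₂, (shiftAvg (X ×ˢ X) fun p => p.1 - p.2)^[k] (ind S) (a - b) := fun a => by
    rw [hg, shiftAvg_iterate_comm]
    simp only [shiftAvg, sub_eq_add_neg]
  simp only [← hcomm, ← hgx]
  have h1 := (Finset.abs_expect_le A₁ fun x =>
    (shiftAvg (X ×ˢ X) fun p => p.1 - p.2)^[k] g x - g x).trans h
  rw [Finset.expect_sub_distrib] at h1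
  linarith [(abs_le.1 h1).1]

section Averaging

variable {G : Type*} [AddCommGroup G] [Fintype G]

lemma innerProd_diffConv_normInd (A₁ A₂ S : Finset G) :
    innerProd (diffConv (normInd A₁) (normInd A₂)) (ind S) =
      𝔼 a ∈ A₁, 𝔼 b ∈ A₂, ind S (a - b) := by
  have h : ∀ a, 𝔼 b ∈ A₂, ind S (a - b) = 𝔼 x, normInd A₂ (a - x) * ind S x := by
    intro a
    rw [← expect_normInd_mul]
    exact Fintype.expect_equiv (Equiv.subLeft a) _ _ fun x => by simp
  rw [← expect_normInd_mul]
  simp only [h, innerProd, diffConv, conj_trivial, Finset.expect_mul, Finset.mul_expect]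
  rw [Finset.expect_comm]
  simp only [mul_assoc]

lemma diffConv_normInd_apply (A₁ A₂ : Finset G) (x : G) :
    diffConv (normInd A₁) (normInd A₂) x = 𝔼 b ∈ A₂, normInd A₁ (b + x) := by
  rw [← expect_normInd_mul, diffConv]
  refine Fintype.expect_equiv (Equiv.subRight x) _ _ fun u => ?_
  simp [mul_comm]

lemma diffConv_normInd_nonneg (A₁ A₂ : Finset G) (x : G) :
    0 ≤ diffConv (normInd A₁) (normInd A₂) x := by
  rw [diffConv_normInd_apply]
  exact Finset.expect_nonneg fun _ _ => normInd_nonneg _ _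

lemma conv_normInd_apply (A D : Finset G) (x : G) :
    conv (normInd A) (normInd D) x = 𝔼 t ∈ D, normInd A (x - t) := by
  rw [← expect_normInd_mul, conv]
  refine Fintype.expect_equiv (Equiv.subLeft x) _ _ fun u => ?_
  simp [mul_comm]

/-- Exchanging the averages over `D` and `A₂` leaves a mean of values of `μ_{A₁} * μ_D`. Symmetry of
`D` reconciles the shift by `+t` with the `-t` of a convolution. -/
lemma expect_diffConv_normInd_le (A₁ : Finset G) {A₂ D : Finset G} (hA₂ : A₂.Nonempty)
    (hD : ∀ t ∈ D, -t ∈ D) (x : G) :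
    𝔼 t ∈ D, diffConv (normInd A₁) (normInd A₂) (t + x) ≤
      ‖conv (normInd A₁) (normInd D)‖ := by
  simp only [diffConv_normInd_apply]
  rw [Finset.expect_comm]
  refine Finset.expect_le hA₂ fun b _ => ?_
  have h : 𝔼 t ∈ D, normInd A₁ (b + (t + x)) = conv (normInd A₁) (normInd D) (b + x) := by
    rw [conv_normInd_apply]
    refine Finset.expect_nbij' (fun t => -t) (fun t => -t) hD hD (by simp) (by simp) ?_
    intro t _
    congr 1
    abel
  rw [h]
  exact (le_abs_self _).trans (norm_le_pi_norm (conv (normInd A₁) (normInd D)) (b + x))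

lemma expect_product_sub_char (X : Finset G) (γ : AddChar G ℂ) :
    𝔼 p ∈ X ×ˢ X, γ (p.1 - p.2) = ((‖𝔼 x ∈ X, γ x‖ ^ 2 : ℝ) : ℂ) := by
  have h : conj (𝔼 x ∈ X, γ x) = 𝔼 x ∈ X, conj (γ x) := by
    rw [Finset.expect_eq_sum_div_card, Finset.expect_eq_sum_div_card]
    simp
  rw [Complex.ofReal_pow, ← Complex.mul_conj', h, Finset.expect_mul_expect,
    Finset.expect_product]
  refine Finset.expect_congr rfl fun x _ => Finset.expect_congr rfl fun y _ => ?_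
  rw [sub_eq_add_neg, AddChar.map_add_eq_mul, AddChar.map_neg_eq_conj]

/-- After averaging over many differences of elements of `X`, the function `μ_{A₁} ∘ μ_{A₂}` is
almost invariant under translations by elements that nearly annihilate the large spectrum
of `X`. -/
lemma abs_shiftAvg_sub_le {A₁ A₂ X : Finset G} (hA₁ : A₁.Nonempty) (hA₂ : A₂.Nonempty)
    (hX : X.Nonempty) {Ω : Type*} {I : Finset Ω} (hI : I.Nonempty) (P : Ω → G) (k : ℕ) {ν : ℝ}
    (hk : 2 * (1 / 4 : ℝ) ^ k ≤ ν) {t : G}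
    (ht : ∀ γ : AddChar G ℂ, 1 / 2 ≤ ‖𝔼 x ∈ X, γ x‖ → ‖γ t - 1‖ ≤ ν) :
    |shiftAvg I P ((shiftAvg (X ×ˢ X) fun p => p.1 - p.2)^[k]
        (diffConv (normInd A₁) (normInd A₂))) t -
      shiftAvg I P ((shiftAvg (X ×ˢ X) fun p => p.1 - p.2)^[k]
        (diffConv (normInd A₁) (normInd A₂))) 0| ≤
      (√(unifMeasure A₁)⁻¹ * √(unifMeasure A₂)⁻¹) * ν := by
  set f : G → ℂ := fun x => (normInd A₁ x : ℂ) with hf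
  set g : G → ℂ := fun x => (normInd A₂ x : ℂ) with hg
  set c : AddChar G ℂ → ℂ := fun γ => dft f γ * conj (dft g γ) with hc
  set q : AddChar G ℂ → ℂ := fun γ => 𝔼 w ∈ I, γ (P w) with hq
  set e : AddChar G ℂ → ℝ := fun γ => ‖𝔼 x ∈ X, γ x‖ with he
  set Ψ := shiftAvg I P ((shiftAvg (X ×ˢ X) fun p => p.1 - p.2)^[k]
        (diffConv (normInd A₁) (normInd A₂))) with hΨ
  have hexp : (fun x => ((Ψ x : ℝ) : ℂ)) =
      fun x => ∑ γ : AddChar G ℂ, c γ * ((e γ ^ 2 : ℝ) : ℂ) ^ k * q γ * γ x := by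
    rw [hΨ, ← shiftAvg_ofReal, ← shiftAvg_iterate_ofReal]
    simp only [← diffConv_ofReal]
    have h0 : (fun x => diffConv f g x) =
        fun x => ∑ γ ∈ (Finset.univ : Finset (AddChar G ℂ)), c γ * γ x :=
      funext fun x => diffConv_eq_sum_dft f g x
    rw [h0, shiftAvg_iterate_sum_char _ _ _ (fun γ : AddChar G ℂ => γ)]
    simp only [expect_product_sub_char]
    rw [shiftAvg_sum_char _ _ _ _ (fun γ : AddChar G ℂ => γ)]
  -- On the large spectrum `γ t` is within `ν` of 1; off it the multiplier is at most `(1/4)^k`,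
  -- against the trivial bound 2 for `‖γ t - 1‖`.
  have hbound : ∀ γ : AddChar G ℂ, ‖((e γ ^ 2 : ℝ) : ℂ) ^ k * q γ * (γ t - 1)‖ ≤ ν := by
    intro γ
    have he0 : 0 ≤ e γ := norm_nonneg _
    have he1 : e γ ≤ 1 := norm_expect_le_one hX fun x _ => (AddChar.norm_apply γ x).le
    have hq1 : ‖q γ‖ ≤ 1 := norm_expect_le_one hI fun w _ => (AddChar.norm_apply γ _).le
    have h2 : ‖γ t - 1‖ ≤ 2 := by
      refine (norm_sub_le _ _).trans ?_
      rw [AddChar.norm_apply, norm_one]; norm_num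
    have hn : ‖((e γ ^ 2 : ℝ) : ℂ) ^ k‖ = (e γ ^ 2) ^ k := by
      rw [norm_pow, Complex.norm_real, Real.norm_eq_abs, abs_of_nonneg (by positivity)]
    rw [norm_mul, norm_mul, hn]
    have h3 : (e γ ^ 2) ^ k * ‖q γ‖ * ‖γ t - 1‖ ≤ (e γ ^ 2) ^ k * 1 * ‖γ t - 1‖ := by gcongr
    refine h3.trans ?_
    rw [mul_one]
    by_cases hγ : 1 / 2 ≤ e γ
    · calc (e γ ^ 2) ^ k * ‖γ t - 1‖ ≤ 1 * ‖γ t - 1‖ := by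
            gcongr
            exact pow_le_one₀ (by positivity) (pow_le_one₀ he0 he1)
        _ ≤ ν := by rw [one_mul]; exact ht γ hγ
    · push Not at hγ
      have h4 : e γ ^ 2 ≤ 1 / 4 := by nlinarith
      calc (e γ ^ 2) ^ k * ‖γ t - 1‖ ≤ (1 / 4) ^ k * 2 := by gcongr
        _ ≤ ν := by linarith
  have hν : 0 ≤ ν := le_trans (by positivity) hk
  have hdiff : ((Ψ t - Ψ 0 : ℝ) : ℂ) =
      ∑ γ : AddChar G ℂ, c γ * (((e γ ^ 2 : ℝ) : ℂ) ^ k * q γ * (γ t - 1)) := by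
    rw [Complex.ofReal_sub, congrFun hexp t, congrFun hexp 0, ← Finset.sum_sub_distrib]
    refine Finset.sum_congr rfl fun γ _ => ?_
    rw [AddChar.map_zero_eq_one]
    ring
  have hsum : ∑ γ : AddChar G ℂ, ‖c γ‖ ≤ √(unifMeasure A₁)⁻¹ * √(unifMeasure A₂)⁻¹ := by
    rw [← expect_norm_normInd_sq hA₁, ← expect_norm_normInd_sq hA₂]
    exact sum_norm_dft_mul_dft_le f g
  rw [← Real.norm_eq_abs, ← Complex.norm_real, hdiff]
  calc _ ≤ ∑ γ : AddChar G ℂ, ‖c γ‖ * ν := norm_sum_le_of_le _ fun γ _ => by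
        rw [norm_mul]
        exact mul_le_mul_of_nonneg_left (hbound γ) (norm_nonneg _)
    _ = (∑ γ : AddChar G ℂ, ‖c γ‖) * ν := by rw [Finset.sum_mul]
    _ ≤ _ := by gcongr

/-- The density increment obtained from a set `X` of almost periods and a symmetric set `D` that
nearly annihilates the large spectrum of `X`. -/
lemma le_norm_conv_of_almost_periods {A₁ A₂ A₁' A₂' S X D : Finset G} (hA₁ : A₁.Nonempty)
    (hA₂ : A₂.Nonempty) (hA₁' : A₁'.Nonempty) (hA₂' : A₂'.Nonempty) (hX : X.Nonempty)
    (hDne : D.Nonempty) (hD : ∀ t ∈ D, -t ∈ D) {η ν τ : ℝ} {k : ℕ}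
    (hper : ∀ t ∈ X, ∀ t' ∈ X, ∀ Y : Finset G, Y.card = A₁'.card →
      𝔼 x ∈ Y, |𝔼 b ∈ A₂', ind S (x + (t - t') - b) - 𝔼 b ∈ A₂', ind S (x - b)| ≤ 2 * η)
    (hk : 2 * (1 / 4 : ℝ) ^ k ≤ ν) (hτ : 0 ≤ τ)
    (hS : ∀ x ∈ S, τ ≤ diffConv (normInd A₁) (normInd A₂) x)
    (hDspec : ∀ γ : AddChar G ℂ, 1 / 2 ≤ ‖𝔼 x ∈ X, γ x‖ → ∀ t ∈ D, ‖γ t - 1‖ ≤ ν) :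
    τ * (innerProd (diffConv (normInd A₁') (normInd A₂')) (ind S) - k * (2 * η)) -
        (√(unifMeasure A₁)⁻¹ * √(unifMeasure A₂)⁻¹) * ν ≤
      ‖conv (normInd A₁) (normInd D)‖ := by
  classical
  set W := diffConv (normInd A₁) (normInd A₂) with hW
  set Av : (G → ℝ) → G → ℝ := shiftAvg (X ×ˢ X) fun p => p.1 - p.2 with hAv
  set Ψ := shiftAvg (A₁' ×ˢ A₂') (fun p => p.1 - p.2) (Av^[k] W) with hΨ
  have hWS : ∀ x, τ * ind S x ≤ W x := by
    intro x
    rw [ind_apply]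
    split_ifs with hx
    · rw [mul_one]; exact hS x hx
    · rw [mul_zero]; exact diffConv_normInd_nonneg _ _ _
  have hΨ0 : τ * (innerProd (diffConv (normInd A₁') (normInd A₂')) (ind S) - k * (2 * η)) ≤
      Ψ 0 := by
    have h1 := le_expect_shiftAvg_iterate_ind hX hper k
    rw [← innerProd_diffConv_normInd] at h1
    refine (mul_le_mul_of_nonneg_left h1 hτ).trans ?_
    rw [hΨ, shiftAvg, Finset.expect_product]
    simp only [Finset.mul_expect, zero_add]
    refine Finset.expect_le_expect fun a _ => Finset.expect_le_expect fun b _ => ?_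
    have h2 := shiftAvg_iterate_mono (X ×ˢ X) (fun p => p.1 - p.2) k hWS (a - b)
    rwa [shiftAvg_iterate_const_mul] at h2
  have hΨt : ∀ t ∈ D, Ψ 0 - (√(unifMeasure A₁)⁻¹ * √(unifMeasure A₂)⁻¹) * ν ≤ Ψ t := by
    intro t ht
    have := abs_shiftAvg_sub_le hA₁ hA₂ hX (hA₁'.product hA₂') (fun p => p.1 - p.2) k hk
      (t := t) fun γ hγ => hDspec γ hγ t ht
    linarith [(abs_le.1 this).1]
  have hlow := Finset.le_expect hDne hΨt
  have hDW : ∀ x, shiftAvg D (fun t => t) W x ≤ ‖conv (normInd A₁) (normInd D)‖ := by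
    intro x
    have := expect_diffConv_normInd_le A₁ hA₂ hD x
    simpa only [shiftAvg, add_comm x] using this
  have hiter : ∀ n x, (Av^[n] (shiftAvg D (fun t => t) W)) x ≤
      ‖conv (normInd A₁) (normInd D)‖ := by
    intro n
    induction n with
    | zero => exact hDW
    | succ n ih =>
      intro x
      rw [Function.iterate_succ_apply']
      exact Finset.expect_le (hX.product hX) fun p _ => ih _
  -- All the averages commute, so the one over `D` can be applied to `W` first; the remaining ones
  -- preserve an upper bound valid everywhere.
  have hup : 𝔼 t ∈ D, Ψ t ≤ ‖conv (normInd A₁) (normInd D)‖ := by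
    have e : 𝔼 t ∈ D, Ψ t = shiftAvg D (fun t => t) Ψ 0 := by simp only [shiftAvg, zero_add]
    rw [e, hΨ, shiftAvg_comm, ← shiftAvg_iterate_comm]
    exact Finset.expect_le (hA₁'.product hA₂') fun p _ => hiter k _
  linarith

end Averaging

/-! ### Dense sets of almost periods and the main theorem -/

section Density

variable {G : Type*}

lemma unifMeasure_eq_relDensity_mul [Fintype G] {A B : Finset G} (hB : B.Nonempty) :
    unifMeasure A = relDensity A B * unifMeasure B := by
  have : (B.card : ℝ) ≠ 0 := by exact_mod_cast hB.card_pos.ne'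
  unfold unifMeasure relDensity
  field_simp

lemma relDensity_le_one {A B : Finset G} (hAB : A ⊆ B) : relDensity A B ≤ 1 := by
  unfold relDensity
  exact div_le_one_of_le₀ (by exact_mod_cast Finset.card_le_card hAB) (by positivity)

lemma nonempty_of_relDensity_pos {A B : Finset G} (h : 0 < relDensity A B) : A.Nonempty := by
  rw [Finset.nonempty_iff_ne_empty]
  rintro rfl
  simp [relDensity] at h

end Density

section Main

variable {G : Type*} [AddCommGroup G] [Fintype G] [DecidableEq G]

/-- A regular Bohr set contains a dense set of almost periods. -/
lemma exists_dense_almost_periods {Γ₁ Γ : Finset (AddChar G ℂ)} (hΓ₁ : Γ₁.Nonempty)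
    (hΓ : Γ.Nonempty) (hcard : Γ₁.card = Γ.card) {ρ₁ ρ : ℝ} (hρ₁ : 0 ≤ ρ₁) (hρ : 0 ≤ ρ)
    (hreg₁ : IsRegularBohr Γ₁ ρ₁) (hreg : IsRegularBohr Γ ρ)
    (hsub : bohr Γ ρ ⊆ bohr Γ₁ (1 / 200 / (Γ.card : ℝ) * ρ₁)) {A₁ A₂ S : Finset G}
    (hA₁ : A₁.Nonempty) (hA₂ : A₂.Nonempty) (hA₁B : A₁ ⊆ bohr Γ₁ ρ₁) (hA₂B : A₂ ⊆ bohr Γ ρ)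
    (hS : S.Nonempty) (hSB : S ⊆ bohr Γ₁ ρ₁ - bohr Γ ρ) {η : ℝ} (hη : 0 < η) {m : ℕ} (hm : 0 < m)
    (hmη : 2 * Real.log (9 / relDensity A₁ (bohr Γ₁ ρ₁)) ≤ m * η ^ 2) {ρT : ℝ} (hρT : 0 ≤ ρT)
    (hρT' : ρT ≤ 1 / (100 * (Γ.card : ℝ)) * ρ) :
    ∃ X ⊆ bohr Γ ρT, X.Nonempty ∧
      ((bohr Γ ρT).card : ℝ) / X.card ≤ 2 * (2 / relDensity A₂ (bohr Γ ρ)) ^ m ∧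
      ∀ t ∈ X, ∀ t' ∈ X, ∀ Y : Finset G, Y.card = A₁.card →
        𝔼 x ∈ Y, |𝔼 b ∈ A₂, ind S (x + (t - t') - b) - 𝔼 b ∈ A₂, ind S (x - b)| ≤ 2 * η := by
  have hB₁ := bohr_card_pos Γ₁ hρ₁
  have hB := bohr_card_pos Γ hρ
  have hA₁0 : (0 : ℝ) < A₁.card := by exact_mod_cast hA₁.card_pos
  have hA₂0 : (0 : ℝ) < A₂.card := by exact_mod_cast hA₂.card_pos
  have hd : (0 : ℝ) < Γ.card := by exact_mod_cast hΓ.card_pos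
  -- Here `c = 1/200` is used: `S + A₂` involves two elements of the smaller Bohr set, each adding
  -- `ρ₁/(200d)` to the width, which reaches exactly the largest dilate covered by regularity.
  have hSA : S + A₂ ⊆ bohr Γ₁ ((1 + 1 / (100 * (Γ₁.card : ℝ))) * ρ₁) := by
    intro x hx
    obtain ⟨s, hs, b, hb, rfl⟩ := Finset.mem_add.1 hx
    obtain ⟨u, hu, v, hv, rfl⟩ := Finset.mem_sub.1 (hSB hs)
    have := add_mem_bohr (sub_mem_bohr hu (hsub hv)) (hsub (hA₂B hb))
    refine bohr_mono Γ₁ (le_of_eq ?_) this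
    rw [hcard]
    field_simp
    ring
  have hSAcard : ((S + A₂).card : ℝ) ≤ 2 / relDensity A₁ (bohr Γ₁ ρ₁) * A₁.card := by
    calc ((S + A₂).card : ℝ) ≤ (bohr Γ₁ ((1 + 1 / (100 * (Γ₁.card : ℝ))) * ρ₁)).card := by
          exact_mod_cast Finset.card_le_card hSA
      _ ≤ 2 * (bohr Γ₁ ρ₁).card := hreg₁.card_dilate_le hΓ₁
      _ = _ := by unfold relDensity; field_simp
  have hAT : A₂ - bohr Γ ρT ⊆ bohr Γ ((1 + 1 / (100 * (Γ.card : ℝ))) * ρ) := by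
    intro x hx
    obtain ⟨b, hb, t, ht, rfl⟩ := Finset.mem_sub.1 hx
    exact bohr_mono Γ (by linarith) (sub_mem_bohr (hA₂B hb) ht)
  have hATcard : ((A₂ - bohr Γ ρT).card : ℝ) ≤ 2 / relDensity A₂ (bohr Γ ρ) * A₂.card := by
    calc ((A₂ - bohr Γ ρT).card : ℝ) ≤
          (bohr Γ ((1 + 1 / (100 * (Γ.card : ℝ))) * ρ)).card := by
          exact_mod_cast Finset.card_le_card hAT
      _ ≤ 2 * (bohr Γ ρ).card := hreg.card_dilate_le hΓ
      _ = _ := by unfold relDensity; field_simp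
  have hα₁ : 0 < relDensity A₁ (bohr Γ₁ ρ₁) := div_pos hA₁0 hB₁
  have hα₂ : 0 < relDensity A₂ (bohr Γ ρ) := div_pos hA₂0 hB
  obtain ⟨X, hXT, hXcard, hper⟩ := exists_almost_periods (T := bohr Γ ρT) hA₂ hS hA₁.card_pos hm
    hα₁ (relDensity_le_one hA₁B) hη hSAcard hmη
  have hT := bohr_card_pos Γ hρT
  have hXne : X.Nonempty := by
    by_contra hne
    rw [Finset.not_nonempty_iff_eq_empty] at hne
    rw [hne] at hXcard
    have : 0 < ((bohr Γ ρT).card : ℝ) * A₂.card ^ m := by positivity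
    simp at hXcard
    linarith
  refine ⟨X, hXT, hXne, ?_, hper⟩
  have hX0 : (0 : ℝ) < X.card := by exact_mod_cast hXne.card_pos
  rw [div_le_iff₀ hX0]
  have h1 : ((bohr Γ ρT).card : ℝ) * A₂.card ^ m ≤
      2 * X.card * (2 / relDensity A₂ (bohr Γ ρ) * A₂.card) ^ m :=
    hXcard.trans (by gcongr)
  rw [mul_pow, ← mul_assoc] at h1
  have h2 := le_of_mul_le_mul_right h1 (by positivity)
  linarith

end Main

/-- The number of characters needed, in terms of the parameters. -/
lemma exists_rank_bound {α₁ α₂ ε σ τ : ℝ} {k m : ℕ} (hα₁ : 0 < α₁) (hα₁1 : α₁ ≤ 1)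
    (hα₂ : 0 < α₂) (hα₂1 : α₂ ≤ 1) (hε : 0 < ε) (hk : 0 < k)
    (hkσ : (k : ℝ) ≤ 8 * logFactor σ) (hm : 0 < m)
    (hmη : (m : ℝ) ≤ 10 * logFactor α₁ / (ε / (32 * k)) ^ 2) (hτ : 0 < τ)
    (hτm : τ ≤ 2 * (2 / α₂) ^ m) :
    ∃ N : ℕ, 0 < N ∧ 8 * Real.log (4 * τ) < N ∧
      (N : ℝ) ≤ 10 ^ 8 * ((ε ^ 2)⁻¹ * logFactor σ ^ 2 * logFactor α₁ * logFactor α₂) := by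
  have hL₁ := half_le_logFactor hα₁ hα₁1
  have hL₂ := half_le_logFactor hα₂ hα₂1
  have hL₂' := logFactor_ge hα₂ hα₂1
  have hm1 : (1 : ℝ) ≤ m := by exact_mod_cast hm
  have hk0 : (0 : ℝ) < k := by exact_mod_cast hk
  have hlog : Real.log (4 * τ) ≤ 4 * (m * logFactor α₂) := by
    have h1 : Real.log (4 * τ) ≤ Real.log (2 ^ 3 * (2 / α₂) ^ m) :=
      Real.log_le_log (by positivity) (by linarith)
    rw [Real.log_mul (x := 2 ^ 3) (by norm_num) (by positivity), Real.log_pow,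
      Real.log_pow] at h1
    have h2 : logFactor α₂ ≤ m * logFactor α₂ := le_mul_of_one_le_left (by linarith) hm1
    have h3 : Real.log (2 / α₂) = logFactor α₂ := rfl
    rw [h3] at h1
    push_cast at h1
    linarith
  have hmL : 1 / 2 ≤ m * logFactor α₂ := by nlinarith
  have hm2 : (m : ℝ) ≤ 655360 * ((ε ^ 2)⁻¹ * logFactor σ ^ 2 * logFactor α₁) := by
    calc (m : ℝ) ≤ 10 * logFactor α₁ / (ε / (32 * k)) ^ 2 := hmη
      _ = 10240 * ((ε ^ 2)⁻¹ * logFactor α₁) * k ^ 2 := by field_simp; ring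
      _ ≤ 10240 * ((ε ^ 2)⁻¹ * logFactor α₁) * (8 * logFactor σ) ^ 2 := by gcongr
      _ = _ := by ring
  refine ⟨⌊32 * (m * logFactor α₂)⌋₊ + 1, Nat.succ_pos _, ?_, ?_⟩
  · push_cast
    have := Nat.lt_floor_add_one (32 * (m * logFactor α₂))
    linarith
  · push_cast
    have h1 := Nat.floor_le (show 0 ≤ 32 * (m * logFactor α₂) by linarith)
    have h2 : m * logFactor α₂ ≤
        655360 * ((ε ^ 2)⁻¹ * logFactor σ ^ 2 * logFactor α₁) * logFactor α₂ := by gcongr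
    have h3 : 0 ≤ (ε ^ 2)⁻¹ * logFactor σ ^ 2 * logFactor α₁ * logFactor α₂ := by positivity
    linarith

/-- The difference of the two sides is `(3/32) ε (1 - ε)`. -/
lemma one_add_half_le {ε : ℝ} (hε : 0 ≤ ε) (hε1 : ε ≤ 1) :
    1 + ε / 2 ≤ (1 + 3 / 4 * ε) * (1 - ε / 8) - ε / 32 := by
  have := mul_nonneg hε (sub_nonneg.2 hε1)
  linarith

end AlmostPeriodicity

end

theorem theoremA4 :
    ∃ c : ℝ, 0 < c ∧ ∃ C : ℝ, 0 < C ∧ ∃ κ : ℝ, 0 < κ ∧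
      ∀ (G : Type*) [AddCommGroup G] [Fintype G] [DecidableEq G] [DecidableEq (AddChar G ℂ)]
        (B A₁ A₂ : Finset G) (α₁ α₂ : ℝ)
        (Γ₁ Γ : Finset (AddChar G ℂ)) (ρ₁ ρ : ℝ) (d : ℕ)
        (A₁' A₂' : Finset G) (α₁' α₂' : ℝ) (ε : ℝ) (S : Finset G),
        -- `A₁`, `A₂` are subsets of `B` of positive densities `α₁`, `α₂`
        B.Nonempty → A₁ ⊆ B → A₂ ⊆ B →
        α₁ = relDensity A₁ B → α₂ = relDensity A₂ B → 0 < α₁ → 0 < α₂ →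
        -- `B⁽¹⁾ = Bohr(Γ₁; ρ₁)` and `B⁽²⁾ = Bohr(Γ; ρ)` are regular Bohr sets of rank `d`
        Γ₁.Nonempty → Γ.Nonempty → 0 ≤ ρ₁ → 0 ≤ ρ → ρ ≤ 2 →
        Γ₁.card = d → Γ.card = d →
        IsRegularBohr Γ₁ ρ₁ → IsRegularBohr Γ ρ →
        bohr Γ ρ ⊆ bohr Γ₁ (c / (d : ℝ) * ρ₁) →
        -- `A₁' ⊆ B⁽¹⁾` and `A₂' ⊆ B⁽²⁾` have positive relative densities `α₁'`, `α₂'`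
        A₁' ⊆ bohr Γ₁ ρ₁ → A₂' ⊆ bohr Γ ρ →
        α₁' = relDensity A₁' (bohr Γ₁ ρ₁) → α₂' = relDensity A₂' (bohr Γ ρ) →
        0 < α₁' → 0 < α₂' →
        0 < ε → ε ≤ 1 →
        S ⊆ bohr Γ₁ ρ₁ - bohr Γ ρ →
        1 - ε / 16 ≤ innerProd (diffConv (normInd A₁') (normInd A₂')) (ind S) →
        (∀ x ∈ S, (1 + 3 / 4 * ε) * (unifMeasure B)⁻¹ ≤
          diffConv (normInd A₁) (normInd A₂) x) →
        ∃ (Δ : Finset (AddChar G ℂ)) (ρ' : ℝ),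
          Δ.Nonempty ∧
          (Δ.card : ℝ) ≤ C * ((ε ^ 2)⁻¹ * logFactor (ε * √(α₁ * α₂)) ^ 2 *
            logFactor α₁' * logFactor α₂') ∧
          κ * (ρ * ε * √(α₁ * α₂) / ((d : ℝ) ^ 3 * (Δ.card : ℝ))) ≤ ρ' ∧
          IsRegularBohr (Γ ∪ Δ) ρ' ∧
          -- the norm on `G → ℝ` is the supremum norm
          (1 + ε / 2) * (unifMeasure B)⁻¹ ≤
            ‖conv (normInd A₁) (normInd (bohr (Γ ∪ Δ) ρ'))‖ := by
  refine ⟨1 / 200, by norm_num, 10 ^ 8, by norm_num, 1 / 10 ^ 10, by norm_num, ?_⟩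
  intro G _ _ _ _ B A₁ A₂ α₁ α₂ Γ₁ Γ ρ₁ ρ d A₁' A₂' α₁' α₂' ε S hB hA₁B hA₂B hα₁ hα₂ hα₁0 hα₂0
    hΓ₁ hΓ hρ₁ hρ hρ2 hΓ₁d hΓd hreg₁ hreg hsub hA₁'B hA₂'B hα₁' hα₂' hα₁'0 hα₂'0 hε hε1 hSB hSin hS
  have hA₁ : A₁.Nonempty := nonempty_of_relDensity_pos (hα₁ ▸ hα₁0)
  have hA₂ : A₂.Nonempty := nonempty_of_relDensity_pos (hα₂ ▸ hα₂0)
  have hA₁' : A₁'.Nonempty := nonempty_of_relDensity_pos (hα₁' ▸ hα₁'0)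
  have hA₂' : A₂'.Nonempty := nonempty_of_relDensity_pos (hα₂' ▸ hα₂'0)
  have hα₁1 : α₁ ≤ 1 := hα₁ ▸ relDensity_le_one hA₁B
  have hα₂1 : α₂ ≤ 1 := hα₂ ▸ relDensity_le_one hA₂B
  have hα₁'1 : α₁' ≤ 1 := hα₁' ▸ relDensity_le_one hA₁'B
  have hα₂'1 : α₂' ≤ 1 := hα₂' ▸ relDensity_le_one hA₂'B
  have hd1 : (1 : ℝ) ≤ d := by rw [← hΓd]; exact_mod_cast hΓ.card_pos
  have hSne : S.Nonempty := by
    rw [Finset.nonempty_iff_ne_empty]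
    rintro rfl
    have h0 : innerProd (diffConv (normInd A₁') (normInd A₂')) (ind ∅) = 0 := by
      rw [innerProd_diffConv_normInd]
      simp [ind]
    rw [h0] at hSin
    linarith
  have hsq0 : 0 < √(α₁ * α₂) := Real.sqrt_pos.2 (mul_pos hα₁0 hα₂0)
  have hsq1 : √(α₁ * α₂) ≤ 1 := Real.sqrt_le_one.2 (mul_le_one₀ hα₁1 hα₂0.le hα₂1)
  set σ := ε * √(α₁ * α₂) with hσ
  have hσ0 : 0 < σ := mul_pos hε hsq0
  have hσ1 : σ ≤ 1 := mul_le_one₀ hε1 hsq0.le hsq1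
  obtain ⟨k, hk0, hkσ, hkL⟩ := exists_iteration_count hσ0 hσ1
  have hk1 : (1 : ℝ) ≤ k := by exact_mod_cast hk0
  have hη0 : 0 < ε / (32 * k) := by positivity
  have hη1 : ε / (32 * k) ≤ 1 := by
    rw [div_le_one (by positivity)]
    linarith
  obtain ⟨m, hm0, hmη, hmL⟩ := exists_sample_size hα₁'0 hα₁'1 hη0 hη1
  -- Almost periods are sought in a smaller regular Bohr set, so that `A₂' - T` has at most twice
  -- the size of `B⁽²⁾`.
  obtain ⟨ρT, hρT1, hρT2, hregT⟩ := exists_isRegularBohr hΓ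
    (w := 1 / (100 * (Γ.card : ℝ)) * ρ) (by positivity)
  have hw0 : 0 ≤ 1 / (100 * (Γ.card : ℝ)) * ρ := by positivity
  have hρT0 : 0 ≤ ρT := by linarith
  obtain ⟨X, hXT, hXne, hXcard, hper⟩ := exists_dense_almost_periods hΓ₁ hΓ (hΓ₁d.trans hΓd.symm)
    hρ₁ hρ hreg₁ hreg (by rwa [hΓd]) hA₁' hA₂' hA₁'B hA₂'B hSne hSB hη0 hm0 (by rwa [← hα₁'])
    hρT0 (by linarith)
  rw [← hα₂'] at hXcard
  have hT := bohr_card_pos Γ hρT0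
  have hX0 : (0 : ℝ) < X.card := by exact_mod_cast hXne.card_pos
  obtain ⟨N, hN0, hN, hNle⟩ := exists_rank_bound hα₁'0 hα₁'1 hα₂'0 hα₂'1 hε hk0 hkL hm0 hmL
    (div_pos hT hX0) hXcard
  have hρTρ : ρT ≤ ρ := by
    have : 1 / (100 * (Γ.card : ℝ)) * ρ ≤ 1 * ρ := by
      rw [hΓd]
      gcongr
      rw [div_le_one (by positivity)]
      linarith
    linarith
  obtain ⟨Δ, ρ', hΔ, hΔN, hρ'0, hρ', hreg', hspec⟩ := exists_bohr_annihilating hΓ hρT0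
    (hρTρ.trans hρ2) hregT hXne hXT hN0 hN (ν := σ / 32) (by positivity) (by linarith)
  have hΔ0 : (0 : ℝ) < Δ.card := by exact_mod_cast hΔ.card_pos
  refine ⟨Δ, ρ', hΔ, le_trans (by exact_mod_cast hΔN) hNle, le_trans ?_ hρ', hreg', ?_⟩
  · rw [hΓd] at hρT1 ⊢
    -- The losses multiply to `100 · 3 · 32 · 720000 = 6912000000`, below `10^10`.
    calc 1 / 10 ^ 10 * (ρ * ε * √(α₁ * α₂) / ((d : ℝ) ^ 3 * Δ.card))
        = 6912 / 10000 * (1 / (100 * (d : ℝ)) * ρ / 3 * (σ / 32) /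
            (720000 * (d : ℝ) ^ 2 * Δ.card)) := by
          rw [hσ]; field_simp; ring
      _ ≤ 1 * (1 / (100 * (d : ℝ)) * ρ / 3 * (σ / 32) / (720000 * (d : ℝ) ^ 2 * Δ.card)) := by
          gcongr
          norm_num
      _ ≤ ρT * (σ / 32) / (720000 * (d : ℝ) ^ 2 * Δ.card) := by
          rw [one_mul]
          gcongr
  · have hμB := unifMeasure_pos hB
    have hmain := le_norm_conv_of_almost_periods hA₁ hA₂ hA₁' hA₂' hXne
      (bohr_nonempty (Γ := Γ ∪ Δ) hρ'0) (fun t ht => neg_mem_bohr ht) hper hkσ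
      (by positivity) hS hspec
    refine le_trans ?_ hmain
    -- The factor `√(α₁α₂)` in `σ` cancels the Parseval loss exactly.
    have hL : √(unifMeasure A₁)⁻¹ * √(unifMeasure A₂)⁻¹ * (σ / 32) =
        ε / 32 * (unifMeasure B)⁻¹ := by
      rw [unifMeasure_eq_relDensity_mul (A := A₁) hB, unifMeasure_eq_relDensity_mul (A := A₂) hB,
        ← hα₁, ← hα₂, ← Real.sqrt_mul (by positivity), ← mul_inv,
        show α₁ * unifMeasure B * (α₂ * unifMeasure B) =
          α₁ * α₂ * (unifMeasure B * unifMeasure B) by ring, Real.sqrt_inv,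
        Real.sqrt_mul (by positivity), Real.sqrt_mul_self hμB.le, hσ]
      field_simp
    have hkη : k * (2 * (ε / (32 * k))) = ε / 16 := by field_simp; norm_num
    rw [hL, hkη]
    have h1 : (1 + 3 / 4 * ε) * (unifMeasure B)⁻¹ * (1 - ε / 8) ≤
        (1 + 3 / 4 * ε) * (unifMeasure B)⁻¹ *
          (innerProd (diffConv (normInd A₁') (normInd A₂')) (ind S) - ε / 16) := by
      exact mul_le_mul_of_nonneg_left (by linarith) (by positivity)
    calc (1 + ε / 2) * (unifMeasure B)⁻¹
        ≤ ((1 + 3 / 4 * ε) * (1 - ε / 8) - ε / 32) * (unifMeasure B)⁻¹ :=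
          mul_le_mul_of_nonneg_right (one_add_half_le hε.le hε1) (inv_pos.2 hμB).le
      _ = (1 + 3 / 4 * ε) * (unifMeasure B)⁻¹ * (1 - ε / 8) - ε / 32 * (unifMeasure B)⁻¹ := by
          ring
      _ ≤ _ := sub_le_sub_right h1 _
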